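/- Let $K$ be a field containing an element of multiplicative order $8$, and let $$G=\mathrm{C}_4\rtimes\mathrm{C}_4=\langle a,b\mid a^4=1=b^4,\ bab^{-1}=a^3\rangle$$ be the non-abelian semidirect product of order $16$ in which a generator of the second factor acts on the first factor by inversion. For a finite dimensional $KG$-module $V$ let $K[V]$ be the coordinate ring of $V$ (the polynomial algebra over $K$ in the coordinate functions with respect to a basis of $V$), with the $G$-action induced by the action on $V$, let $K[V]^G$ be the algebra of invariants, and let $K[V]^G_{\le d}$ be the space of invariants of degree at most $d$. Let $\beta(G,V)$ be the minimal $d\in\mathbb{N}_0$ such that $K[V]^G_{\le d}$ generates the $K$-algebra $K[V]^G$, and let $\beta_{\mathrm{sep}}(G,V)$ be the minimal $d\in\mathbb{N}_0$ such that any two points $v,w\in V$ with $f(v)=f(w)$ for all $f\in K[V]^G_{\le d}$ lie in the same $G$-orbit. Put $$\beta^K(G)=\sup_V\beta(G,V),\qquad \beta_{\mathrm{sep}}^K(G)=\sup_V\beta_{\mathrm{sep}}(G,V),$$ where $V$ runs over all finite dimensional $KG$-modules. Then $$\beta_{\mathrm{sep}}^K(\mathrm{C}_4\rtimes\mathrm{C}_4)=6\qquad\text{and}\qquad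 \beta^K(\mathrm{C}_4\rtimes\mathrm{C}_4)=7;$$ in particular, the separating Noether number of $\mathrm{C}_4\rtimes\mathrm{C}_4$ over $K$ is strictly less than its Noether number over $K$. -/

import Mathlib

/-! ### The group `C₄ ⋊ C₄` -/

/-- The cyclic group of order four, written multiplicatively. -/
abbrev C4 : Type := Multiplicative (ZMod 4)

/-- The action of `C₄` on `C₄` in which a generator acts by inversion `x ↦ x⁻¹ = x³`. -/
def c4Action : C4 →* MulAut C4 where
  toFun k := MulEquiv.inv C4 ^ (Multiplicative.toAdd k).val
  map_one' := by decide
  map_mul' := by decide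

/-- The non-abelian semidirect product
`C₄ ⋊ C₄ = ⟨a, b ∣ a⁴ = 1 = b⁴, b a b⁻¹ = a³⟩` of order sixteen. -/
abbrev C4rtimesC4 : Type := C4 ⋊[c4Action] C4

namespace C4rtimesC4

/-- The generator `a` (of the normal factor). -/
def a : C4rtimesC4 := SemidirectProduct.inl (Multiplicative.ofAdd 1)

/-- The generator `b` (of the complement). -/
def b : C4rtimesC4 := SemidirectProduct.inr (Multiplicative.ofAdd 1)

theorem a_pow_four : a ^ 4 = 1 := by decide

theorem b_pow_four : b ^ 4 = 1 := by decide

theorem conj_a : b * a * b⁻¹ = a ^ 3 := by decide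

theorem card_eq : Nat.card C4rtimesC4 = 16 := by
  rw [SemidirectProduct.card]
  simp [Nat.card_eq_fintype_card, Fintype.card_multiplicative, ZMod.card]

theorem eq_pow_mul_pow (g : C4rtimesC4) : ∃ i j : Fin 4, g = a ^ (i : ℕ) * b ^ (j : ℕ) := by
  obtain ⟨x, y⟩ := g
  revert x y
  decide

end C4rtimesC4

/-! ### Polynomial invariants and the two Noether numbers

A finite dimensional `KG`-module is given, after a choice of a basis, by a representation `ρ` of
`G` on a coordinate space `V = ι → K` with `ι` finite, and its coordinate ring `K[V]` is the
polynomial ring `MvPolynomial ι K`, the variable `X i` being the `i`-th coordinate function.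
(Over a finite field these are polynomials, not polynomial functions.) -/

namespace NoetherNumber

open MvPolynomial

variable {K : Type*} [Field K] {G : Type*} [Group G]
variable {ι : Type*} [Fintype ι] [DecidableEq ι]

/-- The action of `g ∈ G` on `K[V]` by a `K`-algebra homomorphism, `(g • f)(v) = f (g⁻¹ v)`: the
variable `X i` is sent to the `i`-th coordinate of `ρ g⁻¹`, a linear form. -/
noncomputable def act (ρ : Representation K G (ι → K)) (g : G) :
    MvPolynomial ι K →ₐ[K] MvPolynomial ι K :=
  aeval fun i => (LinearMap.toMatrix' (ρ g⁻¹)).toMvPolynomial i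

theorem eval_act (ρ : Representation K G (ι → K)) (g : G) (f : MvPolynomial ι K) (v : ι → K) :
    eval v (act ρ g f) = eval (ρ g⁻¹ v) f := by
  have h : ∀ i, eval v ((LinearMap.toMatrix' (ρ g⁻¹)).toMvPolynomial i) = ρ g⁻¹ v i := by
    intro i
    rw [Matrix.toMvPolynomial_eval_eq_apply, LinearMap.toMatrix'_mulVec]
  induction f using MvPolynomial.induction_on with
  | C r => simp [act]
  | add p q hp hq => simp [hp, hq]
  | mul_X p i hp =>
    rw [map_mul, map_mul, map_mul, hp, eval_X]
    congr 1
    simp [act, h]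

/-- The algebra of invariants `K[V]^G`. -/
noncomputable def invariants (ρ : Representation K G (ι → K)) :
    Subalgebra K (MvPolynomial ι K) where
  carrier := {f | ∀ g : G, act ρ g f = f}
  mul_mem' hp hq g := by rw [map_mul, hp g, hq g]
  add_mem' hp hq g := by rw [map_add, hp g, hq g]
  algebraMap_mem' r g := AlgHom.commutes _ r

/-- `K[V]^G_{≤ d}`: the invariants of degree at most `d`. -/
def invariantsLE (ρ : Representation K G (ι → K)) (d : ℕ) : Set (MvPolynomial ι K) :=
  {f | f ∈ invariants ρ ∧ f.totalDegree ≤ d}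

/-- A set `S` of polynomials is separating if any two points of `V` at which all members of `S`
agree lie in the same `G`-orbit. -/
def IsSeparating (ρ : Representation K G (ι → K)) (S : Set (MvPolynomial ι K)) : Prop :=
  ∀ v w : ι → K, (∀ f ∈ S, eval v f = eval w f) → ∃ g : G, ρ g v = w

/-- `β(G, V)`: the least `d` such that the invariants of degree at most `d` generate the
`K`-algebra `K[V]^G` (and `⊤` if there is no such `d`). -/
noncomputable def betaRep (ρ : Representation K G (ι → K)) : ℕ∞ :=
  ⨅ d : {d : ℕ // Algebra.adjoin K (invariantsLE ρ d) = invariants ρ}, ((d : ℕ) : ℕ∞)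

/-- `β_sep(G, V)`: the least `d` such that the invariants of degree at most `d` form a separating
set (and `⊤` if there is no such `d`). -/
noncomputable def betaSepRep (ρ : Representation K G (ι → K)) : ℕ∞ :=
  ⨅ d : {d : ℕ // IsSeparating ρ (invariantsLE ρ d)}, ((d : ℕ) : ℕ∞)

/-- The Noether number `β^K(G)`: the supremum of `β(G, V)` over all finite dimensional
`KG`-modules `V`. -/
noncomputable def beta (K : Type*) [Field K] (G : Type*) [Group G] : ℕ∞ :=
  ⨆ (n : ℕ) (ρ : Representation K G (Fin n → K)), betaRep ρ

/-- The separating Noether number `β_sep^K(G)`: the supremum of `β_sep(G, V)` over all finite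
dimensional `KG`-modules `V`. -/
noncomputable def betaSep (K : Type*) [Field K] (G : Type*) [Group G] : ℕ∞ :=
  ⨆ (n : ℕ) (ρ : Representation K G (Fin n → K)), betaSepRep ρ

end NoetherNumber

/-!
Write `I` for a primitive fourth root of unity in `K` (a square of an element of order eight).
The characteristic is not two, so that the Reynolds operator is available, and every polynomial is
a combination of products of linear forms which are eigenvectors of the central involutions
`a ^ 2` and `b ^ 2`. A linear form is called odd if `a ^ 2` acts on it by `-1`. The polynomials
fixed by `a ^ 2`, in particular the products of two odd forms, are sums of semi-invariants of linear
characters of the group; these characters form a group isomorphic to `ℤ/2 × ℤ/4`, in which those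
trivial on `b ^ 2` form a Klein four-group. An invariant factor of a product of semi-invariants is
the same thing as a zero-sum subsequence of their characters.

*The Noether number is at most seven* (`betaRep_le_seven`). A product of an odd number of odd forms
has average zero. In any other product the odd forms are paired off, as far as possible with
partners on which `b ^ 2` acts in the same way (`normalForm_cases`). If the degree is at least seven,
then this yields either three factors fixed by `b ^ 2`, possibly after multiplying together pairs of
factors on which `b ^ 2` acts by `-1`, or five factors on which `b ^ 2` acts by `-1`. Three elements
of the Klein four-group, or five characters with a value of order four at `b`, have a zero-sum
subsequence, and so an invariant of degree at most seven splits off (`Step.reynolds_evenLists_mem`).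

*The separating Noether number is at most six* (`betaSepRep_le_six`). Since all invariants together
separate the orbits (`isSeparating_invariants`), it suffices to show that invariants of degree at
most six determine the values of all the others. If all linear semi-invariants on which `b ^ 2`
acts by `-1` vanish at the given points, then only factors fixed by `b ^ 2` matter, and any three
of them contain an invariant of degree at most six. Otherwise some linear semi-invariant `t`, of a
character `c` with a value of order four at `b`, takes the same nonzero value at both points after
one of them is moved by the group (`Anchor`); dividing by powers of `t`, the values of
semi-invariants of small degree whose character is a multiple of `c` are determined. If there is a
second nonvanishing linear semi-invariant whose character is not a multiple of `c`, then all
semi-invariants of degree at most two are determined. If not, then only the polynomials fixed by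
the kernel of `c` matter. These are generated by linear semi-invariants and products of two or four
eigenvectors of a generator of that kernel, and the delicate products, which have a component of
character `c` and degree four, are handled by `Anchor.quad_mem_of_three`.

*Lower bounds.* On the two-dimensional representation `quatRep` the invariants of degree at most five
are symmetric in the two coordinates, while `x y (x ^ 4 - y ^ 4)` is an invariant; thus `(1, ζ)` and
`(ζ, 1)` with `ζ ^ 4 = -1` lie in different orbits (`six_le_betaSepRep_quatRep`). On the sum
`sumRep` of both irreducible representations of dimension two, with coordinates `x, y` and `u, v`,
and a character of order four, with coordinate `t`, the invariant `(x ^ 3 u - I y ^ 3 v) t ^ 3` is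
not generated by invariants of smaller degree (`seven_le_betaRep_sumRep`): the coefficients of the
monomials `x ^ 3 u t ^ k` and `y ^ 3 v t ^ k` are tied together by a relation which holds for the
invariants of degree at most six, and is preserved by products.
-/

namespace NoetherNumber

open MvPolynomial

/-! ### The action on polynomials and the Reynolds operator -/

section Action

variable {K : Type*} [Field K] {G : Type*} [Group G]
variable {ι : Type*} [Fintype ι] [DecidableEq ι]

theorem act_one (ρ : Representation K G (ι → K)) (f : MvPolynomial ι K) : act ρ 1 f = f := by
  have h : act ρ 1 = AlgHom.id K (MvPolynomial ι K) := by
    apply MvPolynomial.algHom_ext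
    intro i
    simp [act, Module.End.one_eq_id, LinearMap.toMatrix'_id, Matrix.toMvPolynomial_one]
  rw [h, AlgHom.id_apply]

theorem act_act (ρ : Representation K G (ι → K)) (g h : G) (f : MvPolynomial ι K) :
    act ρ g (act ρ h f) = act ρ (g * h) f := by
  have H : (act ρ g).comp (act ρ h) = act ρ (g * h) := by
    apply MvPolynomial.algHom_ext
    intro i
    simp only [act, AlgHom.comp_apply, aeval_X, mul_inv_rev, map_mul, LinearMap.toMatrix'_mul,
      Matrix.toMvPolynomial_mul]
    rfl
  rw [← H, AlgHom.comp_apply]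

theorem isHomogeneous_act {ρ : Representation K G (ι → K)} {d : ℕ} {p : MvPolynomial ι K}
    (hp : p.IsHomogeneous d) (g : G) : (act ρ g p).IsHomogeneous d := by
  have := hp.aeval (fun i => (LinearMap.toMatrix' (ρ g⁻¹)).toMvPolynomial i)
    (fun i => Matrix.toMvPolynomial_isHomogeneous _ i)
  rwa [one_mul] at this

theorem mem_invariants {ρ : Representation K G (ι → K)} {f : MvPolynomial ι K} :
    f ∈ invariants ρ ↔ ∀ g : G, act ρ g f = f := Iff.rfl

theorem eval_apply_eq_of_mem_invariants {ρ : Representation K G (ι → K)} {f : MvPolynomial ι K}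
    (hf : f ∈ invariants ρ) (g : G) (v : ι → K) : eval (ρ g v) f = eval v f := by
  have h := eval_act ρ g⁻¹ f v
  rw [hf, inv_inv] at h
  exact h.symm

variable [Fintype G]

/-- The Reynolds operator, the average over the group (meaningful if `|G|` is invertible
in `K`). -/
noncomputable def reynolds (ρ : Representation K G (ι → K)) :
    MvPolynomial ι K →ₗ[K] MvPolynomial ι K :=
  (Fintype.card G : K)⁻¹ • ∑ g : G, (act ρ g).toLinearMap

theorem reynolds_apply (ρ : Representation K G (ι → K)) (f : MvPolynomial ι K) :
    reynolds ρ f = (Fintype.card G : K)⁻¹ • ∑ g : G, act ρ g f := by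
  simp [reynolds]

theorem reynolds_mem (ρ : Representation K G (ι → K)) (f : MvPolynomial ι K) :
    reynolds ρ f ∈ invariants ρ := by
  intro h
  rw [reynolds_apply, map_smul, map_sum]
  simp_rw [act_act]
  congr 1
  exact Fintype.sum_equiv (Equiv.mulLeft h) _ _ fun g => rfl

theorem reynolds_act (ρ : Representation K G (ι → K)) (h : G) (f : MvPolynomial ι K) :
    reynolds ρ (act ρ h f) = reynolds ρ f := by
  rw [reynolds_apply, reynolds_apply]
  simp_rw [act_act]
  congr 1
  exact Fintype.sum_equiv (Equiv.mulRight h) _ _ fun g => rfl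

theorem reynolds_eq_zero_of_act_eq_smul {ρ : Representation K G (ι → K)} {h : G} {c : K}
    {f : MvPolynomial ι K} (hf : act ρ h f = c • f) (hc : c ≠ 1) : reynolds ρ f = 0 := by
  have h1 := reynolds_act ρ h f
  rw [hf, map_smul] at h1
  have h2 : (c - 1) • reynolds ρ f = 0 := by rw [sub_smul, h1, one_smul, sub_self]
  exact (smul_eq_zero.1 h2).resolve_left (sub_ne_zero.2 hc)

theorem reynolds_mul_of_mem {ρ : Representation K G (ι → K)} {q : MvPolynomial ι K}
    (hq : q ∈ invariants ρ) (f : MvPolynomial ι K) :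
    reynolds ρ (q * f) = q * reynolds ρ f := by
  rw [reynolds_apply, reynolds_apply, mul_smul_comm, Finset.mul_sum]
  congr 1
  exact Finset.sum_congr rfl fun g _ => by rw [map_mul, hq g]

theorem reynolds_of_mem {ρ : Representation K G (ι → K)} (hG : (Fintype.card G : K) ≠ 0)
    {f : MvPolynomial ι K} (hf : f ∈ invariants ρ) : reynolds ρ f = f := by
  rw [reynolds_apply, Finset.sum_congr rfl fun g _ => hf g, Finset.sum_const, Finset.card_univ,
    ← Nat.cast_smul_eq_nsmul K, smul_smul, inv_mul_cancel₀ hG, one_smul]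

theorem isHomogeneous_reynolds {ρ : Representation K G (ι → K)} {d : ℕ} {p : MvPolynomial ι K}
    (hp : p.IsHomogeneous d) : (reynolds ρ p).IsHomogeneous d := by
  rw [reynolds_apply]
  exact (homogeneousSubmodule ι K d).smul_mem _
    ((homogeneousSubmodule ι K d).sum_mem fun g _ => isHomogeneous_act hp g)

/-- The invariants of a finite group separate its orbits, over any field: a product of affine
linear functions gives a polynomial `p` which vanishes on the orbit of `v` and takes the value `1`
at `w`; then `∏ g, g • (1 - p)` is an invariant with value `1` at `v` and `0` at `w`. -/
theorem isSeparating_invariants (ρ : Representation K G (ι → K)) :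
    IsSeparating ρ (invariants ρ : Set (MvPolynomial ι K)) := by
  intro v w hvw
  by_contra! hne
  have hlin : ∀ g : G, ∃ p : MvPolynomial ι K, eval (ρ g v) p = 0 ∧ eval w p = 1 := by
    intro g
    obtain ⟨i, hi⟩ := Function.ne_iff.1 (hne g)
    refine ⟨C ((w i - ρ g v i)⁻¹) * (X i - C (ρ g v i)), by simp, ?_⟩
    simp only [map_mul, map_sub, eval_C, eval_X]
    exact inv_mul_cancel₀ (sub_ne_zero.2 (Ne.symm hi))
  choose p hp0 hp1 using hlin
  set q : MvPolynomial ι K := 1 - ∏ g, p g with hq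
  have hinv : ∏ h : G, act ρ h q ∈ invariants ρ := by
    intro g
    rw [map_prod]
    simp_rw [act_act]
    exact Fintype.prod_equiv (Equiv.mulLeft g) _ _ fun h => rfl
  have h := hvw _ hinv
  rw [map_prod, map_prod] at h
  simp_rw [eval_act] at h
  have hv : ∀ g : G, eval (ρ g⁻¹ v) q = 1 := by
    intro g
    rw [hq, map_sub, map_one, map_prod, Finset.prod_eq_zero (Finset.mem_univ g⁻¹) (hp0 g⁻¹),
      sub_zero]
  have hw : eval (ρ (1 : G)⁻¹ w) q = 0 := by
    rw [hq, inv_one, map_one, Module.End.one_apply, map_sub, map_one, map_prod,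
      Finset.prod_eq_one fun g _ => hp1 g, sub_self]
  rw [Finset.prod_eq_one fun g _ => hv g, Finset.prod_eq_zero (Finset.mem_univ 1) hw] at h
  exact one_ne_zero h

end Action

theorem le_betaRep {K : Type*} [Field K] {G : Type*} [Group G] {ι : Type*} [Fintype ι]
    [DecidableEq ι] {ρ : Representation K G (ι → K)} {m : ℕ} {f : MvPolynomial ι K}
    (hf : f ∈ invariants ρ) (hfm : ∀ d < m, f ∉ Algebra.adjoin K (invariantsLE ρ d)) :
    (m : ℕ∞) ≤ betaRep ρ := by
  refine le_iInf fun d => ?_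
  by_contra h
  have hd : (d : ℕ) < m := by exact_mod_cast not_le.1 h
  exact hfm d hd (by rw [d.2]; exact hf)

theorem le_betaSepRep {K : Type*} [Field K] {G : Type*} [Group G] {ι : Type*} [Fintype ι]
    [DecidableEq ι] {ρ : Representation K G (ι → K)} {m : ℕ} {v w : ι → K}
    (hvw : ∀ d < m, ∀ f ∈ invariantsLE ρ d, eval v f = eval w f) (hne : ∀ g, ρ g v ≠ w) :
    (m : ℕ∞) ≤ betaSepRep ρ := by
  refine le_iInf fun d => ?_
  by_contra h
  have hd : (d : ℕ) < m := by exact_mod_cast not_le.1 h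
  obtain ⟨g, hg⟩ := d.2 v w (hvw d hd)
  exact hne g hg

end NoetherNumber

/-! ### Semi-invariants of `C₄ ⋊ C₄` -/

instance : Fintype C4rtimesC4 := Fintype.ofEquiv _ SemidirectProduct.equivProd.symm

namespace NoetherNumber

open MvPolynomial C4rtimesC4

/-- The group of linear characters of `C₄ ⋊ C₄` over a field with a primitive fourth root of
unity `I`: the pair `c` stands for the character `a ↦ (-1) ^ c.1`, `b ↦ I ^ c.2`. -/
abbrev Ch : Type := ZMod 2 × ZMod 4

theorem neg_one_pow_val_add {R : Type*} [Ring R] (x y : ZMod 2) :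
    (-1 : R) ^ (x + y).val = (-1) ^ x.val * (-1) ^ y.val := by
  rw [ZMod.val_add, ← pow_add, ← pow_eq_pow_mod (x.val + y.val) (by simp : (-1 : R) ^ 2 = 1)]

theorem pow_val_add_of_sq_eq_neg_one {R : Type*} [Ring R] {I : R} (hI : I ^ 2 = -1)
    (x y : ZMod 4) : I ^ (x + y).val = I ^ x.val * I ^ y.val := by
  have h4 : I ^ 4 = 1 := by rw [show 4 = 2 * 2 from rfl, pow_mul, hI]; simp
  rw [ZMod.val_add, ← pow_add, ← pow_eq_pow_mod (x.val + y.val) h4]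

section Defs

variable {K : Type*} [Field K] {ι : Type*} [Fintype ι] [DecidableEq ι]

/-- Homogeneous semi-invariants of degree `d` belonging to the linear character `c`. -/
structure IsSemi (ρ : Representation K C4rtimesC4 (ι → K)) (I : K) (d : ℕ) (c : Ch)
    (p : MvPolynomial ι K) : Prop where
  homog : p.IsHomogeneous d
  act_a : act ρ a p = (-1 : K) ^ c.1.val • p
  act_b : act ρ b p = I ^ c.2.val • p

/-- Homogeneous polynomials of degree `d` on which the central elements `a ^ 2` and `b ^ 2` act
by the scalars `1` and `σ`. They are sums of semi-invariants. -/
structure IsEven (ρ : Representation K C4rtimesC4 (ι → K)) (σ : K) (d : ℕ)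
    (p : MvPolynomial ι K) : Prop where
  homog : p.IsHomogeneous d
  act_aa : act ρ (a ^ 2) p = p
  act_bb : act ρ (b ^ 2) p = σ • p

/-- Linear forms on which the central elements `a ^ 2` and `b ^ 2` act by the scalars `-1` and
`σ`. For `σ = 1` and `σ = -1` these span copies of the two irreducible modules of dimension
two. -/
structure IsOdd (ρ : Representation K C4rtimesC4 (ι → K)) (σ : K)
    (p : MvPolynomial ι K) : Prop where
  homog : p.IsHomogeneous 1
  act_aa : act ρ (a ^ 2) p = -p
  act_bb : act ρ (b ^ 2) p = σ • p

variable {ρ : Representation K C4rtimesC4 (ι → K)} {I : K} {d d' : ℕ} {c c' : Ch}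
variable {p q : MvPolynomial ι K} {σ σ' : K}

theorem act_pow_of_act_eq_smul {g : C4rtimesC4} {μ : K} (h : act ρ g p = μ • p) (n : ℕ) :
    act ρ (g ^ n) p = μ ^ n • p := by
  induction n with
  | zero => simp [act_one]
  | succ n ih => rw [pow_succ, ← act_act, h, map_smul, ih, smul_smul, pow_succ, mul_comm]

theorem mem_invariants_of_generators (ha : act ρ a p = p) (hb : act ρ b p = p) :
    p ∈ invariants ρ := by
  intro g
  obtain ⟨i, j, rfl⟩ := eq_pow_mul_pow g
  rw [← act_act, act_pow_of_act_eq_smul (g := b) (μ := 1) (by rw [hb, one_smul]), one_pow, one_smul,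
    act_pow_of_act_eq_smul (g := a) (μ := 1) (by rw [ha, one_smul]), one_pow, one_smul]

namespace IsSemi

theorem mem_invariants (h : IsSemi ρ I d 0 p) : p ∈ invariants ρ :=
  mem_invariants_of_generators (by simpa using h.act_a) (by simpa using h.act_b)

protected theorem one : IsSemi ρ I 0 0 1 :=
  ⟨isHomogeneous_one _ _, by simp, by simp⟩

theorem mul (hI : I ^ 2 = -1) (hp : IsSemi ρ I d c p) (hq : IsSemi ρ I d' c' q) :
    IsSemi ρ I (d + d') (c + c') (p * q) where
  homog := hp.homog.mul hq.homog
  act_a := by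
    rw [map_mul, hp.act_a, hq.act_a, smul_mul_smul_comm, Prod.fst_add, neg_one_pow_val_add]
  act_b := by
    rw [map_mul, hp.act_b, hq.act_b, smul_mul_smul_comm, Prod.snd_add,
      pow_val_add_of_sq_eq_neg_one hI]

theorem pow (hI : I ^ 2 = -1) (hp : IsSemi ρ I d c p) (n : ℕ) :
    IsSemi ρ I (n * d) (n • c) (p ^ n) := by
  induction n with
  | zero => simpa using IsSemi.one
  | succ n ih => simpa only [pow_succ, succ_nsmul, Nat.succ_mul] using ih.mul hI hp

theorem prod (hI : I ^ 2 = -1) {κ : Type*} (s : Finset κ) {f : κ → MvPolynomial ι K} {d : κ → ℕ}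
    {c : κ → Ch} (h : ∀ i ∈ s, IsSemi ρ I (d i) (c i) (f i)) :
    IsSemi ρ I (∑ i ∈ s, d i) (∑ i ∈ s, c i) (∏ i ∈ s, f i) := by
  classical
  induction s using Finset.induction_on with
  | empty => simpa using IsSemi.one
  | insert x s hx ih =>
    rw [Finset.sum_insert hx, Finset.sum_insert hx, Finset.prod_insert hx]
    exact (h x (Finset.mem_insert_self x s)).mul hI
      (ih fun i hi => h i (Finset.mem_insert_of_mem hi))

end IsSemi

namespace IsEven

theorem mul (hp : IsEven ρ σ d p) (hq : IsEven ρ σ' d' q) :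
    IsEven ρ (σ * σ') (d + d') (p * q) where
  homog := hp.homog.mul hq.homog
  act_aa := by rw [map_mul, hp.act_aa, hq.act_aa]
  act_bb := by rw [map_mul, hp.act_bb, hq.act_bb, smul_mul_smul_comm]

/-- The sum `p + ε a p + κ b p + ε κ a b p` is a semi-invariant when `ε² = 1` and `κ² = σ`. -/
theorem act_sum (hp : IsEven ρ σ d p) {ε κ : K} (hε : ε * ε = 1) (hκ : κ * κ = σ)
    (hσ : σ * σ = 1) {q : MvPolynomial ι K}
    (hq : q = p + ε • act ρ a p + κ • act ρ b p + (ε * κ) • act ρ (a * b) p) :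
    q.IsHomogeneous d ∧ act ρ a q = ε • q ∧ act ρ b q = (σ * κ) • q := by
  have e1 : act ρ (a * a) p = p := by rw [← sq, hp.act_aa]
  have e2 : act ρ (a * (a * b)) p = act ρ b p := by
    rw [show a * (a * b) = b * a ^ 2 by decide, ← act_act, hp.act_aa]
  have e3 : act ρ (b * a) p = act ρ (a * b) p := by
    rw [show b * a = (a * b) * a ^ 2 by decide, ← act_act, hp.act_aa]
  have e4 : act ρ (b * b) p = σ • p := by rw [← sq, hp.act_bb]
  have e5 : act ρ (b * (a * b)) p = σ • act ρ a p := by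
    rw [show b * (a * b) = (a * b ^ 2) * a ^ 2 by decide, ← act_act, hp.act_aa, ← act_act,
      hp.act_bb, map_smul]
  subst hq
  refine ⟨?_, ?_, ?_⟩
  · refine (((hp.homog.add ?_).add ?_).add ?_) <;>
      exact (homogeneousSubmodule ι K d).smul_mem _ (isHomogeneous_act hp.homog _)
  · simp only [map_add, map_smul, act_act, e1, e2]
    simp only [smul_add, smul_smul, ← mul_assoc, hε]
    module
  · simp only [map_add, map_smul, act_act, e3, e4, e5]
    simp only [smul_add, smul_smul]
    rw [show κ * σ = σ * κ by ring, show σ * κ * κ = 1 by rw [mul_assoc, hκ, hσ],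
      show σ * κ * (ε * κ) = ε by
        rw [show σ * κ * (ε * κ) = σ * (κ * κ) * ε by ring, hκ, hσ, one_mul],
      show ε * κ * σ = σ * κ * ε by ring]
    module

/-- A product with a factor on which `a ^ 2` and `b ^ 2` act trivially lies in a given submodule
as soon as the products with the semi-invariants of the characters trivial on `b ^ 2` do. -/
theorem mul_mem_of_one (hI : I ^ 2 = -1) (h2 : (2 : K) ≠ 0) (hp : IsEven ρ 1 d p)
    (r : MvPolynomial ι K) (M : Submodule K (MvPolynomial ι K))
    (h : ∀ c : Ch, c.2 = 0 ∨ c.2 = 2 → ∀ q, IsSemi ρ I d c q → q * r ∈ M) : p * r ∈ M := by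
  have key : ∀ (x : ZMod 2) (y : ZMod 4) (κ : K), y = 0 ∨ y = 2 → κ * κ = 1 → κ = I ^ y.val →
      (p + ((-1 : K) ^ x.val) • act ρ a p + κ • act ρ b p +
        ((-1 : K) ^ x.val * κ) • act ρ (a * b) p) * r ∈ M := by
    intro x y κ hy hκ hκy
    obtain ⟨h1, h2, h3⟩ := hp.act_sum (ε := (-1 : K) ^ x.val)
      (by rw [← mul_pow]; simp) hκ (by ring) rfl
    exact h (x, y) hy _ ⟨h1, h2, by rw [h3, one_mul, hκy]⟩
  have v2 : (2 : ZMod 4).val = 2 := rfl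
  have k1 := key 0 0 1 (by simp) (by ring) (by simp)
  have k2 := key 1 0 1 (by simp) (by ring) (by simp)
  have k3 := key 0 2 (-1) (by simp) (by ring) (by rw [v2, hI])
  have k4 := key 1 2 (-1) (by simp) (by ring) (by rw [v2, hI])
  have k := M.smul_mem ((2 : K)⁻¹ * (2 : K)⁻¹) (M.add_mem (M.add_mem k1 k2) (M.add_mem k3 k4))
  convert k using 1
  simp only [ZMod.val_zero, ZMod.val_one, pow_zero, pow_one, ← add_mul, ← smul_mul_assoc]
  congr 1
  match_scalars <;> field_simp <;> ring

/-- A product with a factor on which `a ^ 2` acts trivially and `b ^ 2` by `-1` lies in a given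
submodule as soon as the products with the semi-invariants of the characters nontrivial on
`b ^ 2` do. -/
theorem mul_mem_of_neg_one (hI : I ^ 2 = -1) (h2 : (2 : K) ≠ 0) (hp : IsEven ρ (-1) d p)
    (r : MvPolynomial ι K) (M : Submodule K (MvPolynomial ι K))
    (h : ∀ c : Ch, c.2 = 1 ∨ c.2 = 3 → ∀ q, IsSemi ρ I d c q → q * r ∈ M) : p * r ∈ M := by
  have key : ∀ (x : ZMod 2) (y : ZMod 4) (κ : K), y = 1 ∨ y = 3 → κ * κ = -1 → -κ = I ^ y.val →
      (p + ((-1 : K) ^ x.val) • act ρ a p + κ • act ρ b p +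
        ((-1 : K) ^ x.val * κ) • act ρ (a * b) p) * r ∈ M := by
    intro x y κ hy hκ hκy
    obtain ⟨h1, h2, h3⟩ := hp.act_sum (ε := (-1 : K) ^ x.val)
      (by rw [← mul_pow]; simp) hκ (by ring) rfl
    exact h (x, y) hy _ ⟨h1, h2, by rw [h3, ← hκy, neg_one_mul]⟩
  have v1 : (1 : ZMod 4).val = 1 := rfl
  have v3 : (3 : ZMod 4).val = 3 := rfl
  have hI1 : I * I = -1 := by rw [← sq, hI]
  have hI3 : I ^ 3 = -I := by rw [pow_succ, hI]; ring
  have k1 := key 0 1 (-I) (by simp) (by rw [neg_mul_neg, hI1]) (by rw [v1]; ring)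
  have k2 := key 1 1 (-I) (by simp) (by rw [neg_mul_neg, hI1]) (by rw [v1]; ring)
  have k3 := key 0 3 I (by simp) hI1 (by rw [v3, hI3])
  have k4 := key 1 3 I (by simp) hI1 (by rw [v3, hI3])
  have k := M.smul_mem ((2 : K)⁻¹ * (2 : K)⁻¹) (M.add_mem (M.add_mem k1 k2) (M.add_mem k3 k4))
  convert k using 1
  simp only [ZMod.val_zero, ZMod.val_one, pow_zero, pow_one, ← add_mul, ← smul_mul_assoc]
  congr 1
  match_scalars <;> field_simp <;> ring

end IsEven

theorem IsOdd.mul (hp : IsOdd ρ σ p) (hq : IsOdd ρ σ' q) : IsEven ρ (σ * σ') 2 (p * q) where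
  homog := hp.homog.mul hq.homog
  act_aa := by rw [map_mul, hp.act_aa, hq.act_aa, neg_mul_neg]
  act_bb := by rw [map_mul, hp.act_bb, hq.act_bb, smul_mul_smul_comm]

variable (ρ) in
/-- The linear forms which are eigenvectors of both central elements `a ^ 2` and `b ^ 2`. -/
def centralForms : Set (MvPolynomial ι K) :=
  {p | IsOdd ρ 1 p ∨ IsOdd ρ (-1) p ∨ IsEven ρ 1 1 p ∨ IsEven ρ (-1) 1 p}

theorem adjoin_centralForms (h2 : (2 : K) ≠ 0) : Algebra.adjoin K (centralForms ρ) = ⊤ := by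
  rw [eq_top_iff, ← MvPolynomial.adjoin_range_X, Algebra.adjoin_le_iff]
  rintro _ ⟨i, rfl⟩
  have hX : (X i : MvPolynomial ι K).IsHomogeneous 1 := isHomogeneous_X _ _
  set z : MvPolynomial ι K := act ρ (a ^ 2) (X i) with hz
  set w : MvPolynomial ι K := act ρ (b ^ 2) (X i) with hw
  set y : MvPolynomial ι K := act ρ (a ^ 2 * b ^ 2) (X i) with hy
  have hom : ∀ s t : K, (X i + s • z + t • w + (s * t) • y).IsHomogeneous 1 := by
    intro s t
    refine ((hX.add ?_).add ?_).add ?_ <;>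
      exact (homogeneousSubmodule ι K 1).smul_mem _ (isHomogeneous_act hX _)
  have za : act ρ (a ^ 2) z = X i := by
    rw [hz, act_act, show a ^ 2 * a ^ 2 = 1 by decide, act_one]
  have wa : act ρ (a ^ 2) w = y := by rw [hw, act_act]
  have ya : act ρ (a ^ 2) y = w := by
    rw [hy, act_act, show a ^ 2 * (a ^ 2 * b ^ 2) = b ^ 2 by decide]
  have zb : act ρ (b ^ 2) z = y := by
    rw [hz, act_act, show b ^ 2 * a ^ 2 = a ^ 2 * b ^ 2 by decide]
  have wb : act ρ (b ^ 2) w = X i := by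
    rw [hw, act_act, show b ^ 2 * b ^ 2 = 1 by decide, act_one]
  have yb : act ρ (b ^ 2) y = z := by
    rw [hy, act_act, show b ^ 2 * (a ^ 2 * b ^ 2) = a ^ 2 by decide]
  have actA : ∀ s t : K, s * s = 1 → act ρ (a ^ 2) (X i + s • z + t • w + (s * t) • y) =
      s • (X i + s • z + t • w + (s * t) • y) := by
    intro s t hs
    simp only [map_add, map_smul, za, wa, ya, smul_add, smul_smul, ← mul_assoc, hs]
    rw [← hz]
    module
  have actB : ∀ s t : K, t * t = 1 → act ρ (b ^ 2) (X i + s • z + t • w + (s * t) • y) =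
      t • (X i + s • z + t • w + (s * t) • y) := by
    intro s t ht
    simp only [map_add, map_smul, zb, wb, yb, smul_add, smul_smul, ← mul_assoc, ht]
    rw [← hw, show t * s * t = s by rw [mul_right_comm, ht, one_mul]]
    module
  have m : ∀ s t : K, s = 1 ∨ s = -1 → t = 1 ∨ t = -1 →
      X i + s • z + t • w + (s * t) • y ∈ Algebra.adjoin K (centralForms ρ) := by
    intro s t hs ht
    refine Algebra.subset_adjoin ?_
    have hA := actA s t (by rcases hs with rfl | rfl <;> ring)
    have hB := actB s t (by rcases ht with rfl | rfl <;> ring)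
    rcases hs with rfl | rfl
    · replace hA := hA.trans (one_smul K _)
      rcases ht with rfl | rfl
      · exact Or.inr (Or.inr (Or.inl ⟨hom _ _, hA, hB⟩))
      · exact Or.inr (Or.inr (Or.inr ⟨hom _ _, hA, hB⟩))
    · replace hA := hA.trans (neg_one_smul K _)
      rcases ht with rfl | rfl
      · exact Or.inl ⟨hom _ _, hA, hB⟩
      · exact Or.inr (Or.inl ⟨hom _ _, hA, hB⟩)
  have k := Subalgebra.smul_mem _ (add_mem
    (add_mem (m 1 1 (.inl rfl) (.inl rfl)) (m (-1) 1 (.inr rfl) (.inl rfl)))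
    (add_mem (m 1 (-1) (.inl rfl) (.inr rfl)) (m (-1) (-1) (.inr rfl) (.inr rfl))))
    ((2 : K)⁻¹ * (2 : K)⁻¹)
  simp only [SetLike.mem_coe]
  convert k using 1
  match_scalars <;> field_simp <;> ring

end Defs

end NoetherNumber

namespace NoetherNumber

open MvPolynomial C4rtimesC4

/-! ### Normal form of products of linear forms -/

section NormalForm

variable {K : Type*} [Field K] {ι : Type*} [Fintype ι] [DecidableEq ι]
variable {ρ : Representation K C4rtimesC4 (ι → K)} {I : K}

/-- A product of linear forms after pairing off the odd ones of equal type: `r₀` and `r₁` are the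
unpaired odd forms of the two types (or `1`), and the lists `l₀` and `l₁` hold the even factors,
with their degrees, on which `b ^ 2` acts by `1` and by `-1`. -/
theorem exists_normalForm_of_mem_closure {m : MvPolynomial ι K}
    (hm : m ∈ Submonoid.closure (centralForms ρ)) :
    ∃ (r₀ r₁ : MvPolynomial ι K) (l₀ l₁ : List (MvPolynomial ι K × ℕ)),
      (r₀ = 1 ∨ IsOdd ρ 1 r₀) ∧ (r₁ = 1 ∨ IsOdd ρ (-1) r₁) ∧
      (∀ x ∈ l₀, IsEven ρ 1 x.2 x.1 ∧ 1 ≤ x.2 ∧ x.2 ≤ 2) ∧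
      (∀ x ∈ l₁, IsEven ρ (-1) x.2 x.1 ∧ x.2 = 1) ∧
      m = r₀ * r₁ * (l₀.map Prod.fst).prod * (l₁.map Prod.fst).prod := by
  induction hm using Submonoid.closure_induction_left with
  | one => exact ⟨1, 1, [], [], by simp⟩
  | mul_left x hx y _ ih =>
    obtain ⟨r₀, r₁, l₀, l₁, h₀, h₁, hl₀, hl₁, rfl⟩ := ih
    rcases hx with hx | hx | hx | hx
    · rcases h₀ with rfl | h₀
      · exact ⟨x, r₁, l₀, l₁, .inr hx, h₁, hl₀, hl₁, by ring⟩
      · refine ⟨1, r₁, (x * r₀, 2) :: l₀, l₁, .inl rfl, h₁, ?_, hl₁, by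
          simp only [List.map_cons, List.prod_cons]; ring⟩
        refine List.forall_mem_cons.2 ⟨⟨?_, by norm_num, le_rfl⟩, hl₀⟩
        simpa using hx.mul h₀
    · rcases h₁ with rfl | h₁
      · exact ⟨r₀, x, l₀, l₁, h₀, .inr hx, hl₀, hl₁, by ring⟩
      · refine ⟨r₀, 1, (x * r₁, 2) :: l₀, l₁, h₀, .inl rfl, ?_, hl₁, by
          simp only [List.map_cons, List.prod_cons]; ring⟩
        refine List.forall_mem_cons.2 ⟨⟨?_, by norm_num, le_rfl⟩, hl₀⟩
        simpa using hx.mul h₁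
    · exact ⟨r₀, r₁, (x, 1) :: l₀, l₁, h₀, h₁,
        List.forall_mem_cons.2 ⟨⟨hx, le_rfl, by norm_num⟩, hl₀⟩, hl₁, by
          simp only [List.map_cons, List.prod_cons]; ring⟩
    · exact ⟨r₀, r₁, l₀, (x, 1) :: l₁, h₀, h₁, hl₀,
        List.forall_mem_cons.2 ⟨⟨hx, rfl⟩, hl₁⟩, by
          simp only [List.map_cons, List.prod_cons]; ring⟩

/-- A product of even factors, given with their degrees: `b ^ 2` acts by `1` on the factors in
`l₀`, which are of degree at most two, and by `-1` on those in `l₁`, of which only the first may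
be of degree two. -/
structure EvenLists (ρ : Representation K C4rtimesC4 (ι → K))
    (l₀ l₁ : List (MvPolynomial ι K × ℕ)) : Prop where
  left : ∀ x ∈ l₀, IsEven ρ 1 x.2 x.1 ∧ 1 ≤ x.2 ∧ x.2 ≤ 2
  right : ∀ x ∈ l₁, IsEven ρ (-1) x.2 x.1 ∧ 1 ≤ x.2 ∧ x.2 ≤ 2
  tail : ∀ x ∈ l₁.tail, x.2 = 1

omit [Fintype ι] [DecidableEq ι] in
theorem isHomogeneous_list_prod {l : List (MvPolynomial ι K × ℕ)}
    (h : ∀ x ∈ l, x.1.IsHomogeneous x.2) :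
    (l.map Prod.fst).prod.IsHomogeneous (l.map Prod.snd).sum := by
  induction l with
  | nil => exact isHomogeneous_one _ _
  | cons x l ih =>
    simp only [List.map_cons, List.prod_cons, List.sum_cons]
    exact (h x List.mem_cons_self).mul (ih fun y hy => h y (List.mem_cons_of_mem x hy))

theorem act_list_prod_eq {g : C4rtimesC4} {l : List (MvPolynomial ι K × ℕ)}
    (h : ∀ x ∈ l, act ρ g x.1 = x.1) :
    act ρ g (l.map Prod.fst).prod = (l.map Prod.fst).prod := by
  rw [map_list_prod, List.map_map]
  congr 1
  exact List.map_congr_left h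

theorem normalForm_cases {m : MvPolynomial ι K}
    (hm : m ∈ Submonoid.closure (centralForms ρ)) :
    (∃ n, m.IsHomogeneous n ∧ act ρ (a ^ 2) m = -m) ∨
    ∃ l₀ l₁ : List (MvPolynomial ι K × ℕ), EvenLists ρ l₀ l₁ ∧
      m = (l₀.map Prod.fst).prod * (l₁.map Prod.fst).prod := by
  obtain ⟨r₀, r₁, l₀, l₁, h₀, h₁, hl₀, hl₁, rfl⟩ := exists_normalForm_of_mem_closure hm
  have p₀ := isHomogeneous_list_prod fun x hx => (hl₀ x hx).1.homog
  have p₁ := isHomogeneous_list_prod fun x hx => (hl₁ x hx).1.homog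
  have q₀ := act_list_prod_eq fun x hx => (hl₀ x hx).1.act_aa
  have q₁ := act_list_prod_eq fun x hx => (hl₁ x hx).1.act_aa
  rcases h₀ with rfl | h₀ <;> rcases h₁ with rfl | h₁
  · refine .inr ⟨l₀, l₁, ⟨hl₀, fun x hx => ⟨(hl₁ x hx).1, (hl₁ x hx).2.ge, by
      rw [(hl₁ x hx).2]; norm_num⟩, fun x hx => (hl₁ x (List.mem_of_mem_tail hx)).2⟩, by ring⟩
  · exact .inl ⟨_, (((isHomogeneous_one _ _).mul h₁.homog).mul p₀).mul p₁, by
      rw [map_mul, map_mul, map_mul, map_one, h₁.act_aa, q₀, q₁]; ring⟩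
  · exact .inl ⟨_, ((h₀.homog.mul (isHomogeneous_one _ _)).mul p₀).mul p₁, by
      rw [map_mul, map_mul, map_mul, map_one, h₀.act_aa, q₀, q₁]; ring⟩
  · refine .inr ⟨l₀, (r₀ * r₁, 2) :: l₁, ⟨hl₀, ?_, fun x hx => (hl₁ x hx).2⟩, by
      simp only [List.map_cons, List.prod_cons]; ring⟩
    refine List.forall_mem_cons.2 ⟨⟨?_, by norm_num, le_rfl⟩, fun x hx => ⟨(hl₁ x hx).1,
      (hl₁ x hx).2.ge, by rw [(hl₁ x hx).2]; norm_num⟩⟩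
    simpa using h₀.mul h₁

/-- To prove that a homogeneous polynomial lies in a subspace it suffices to treat the polynomials
on which `a ^ 2` acts by `-1` and the products of even factors. -/
theorem mem_of_normalForm (h2 : (2 : K) ≠ 0) {n : ℕ} {p : MvPolynomial ι K}
    (hp : p.IsHomogeneous n) (M : Submodule K (MvPolynomial ι K))
    (hodd : ∀ m : MvPolynomial ι K, m.IsHomogeneous n → act ρ (a ^ 2) m = -m → m ∈ M)
    (heven : ∀ l₀ l₁ : List (MvPolynomial ι K × ℕ), EvenLists ρ l₀ l₁ →
      (l₀.map Prod.snd).sum + (l₁.map Prod.snd).sum = n →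
      (l₀.map Prod.fst).prod * (l₁.map Prod.fst).prod ∈ M) : p ∈ M := by
  have key : (⊤ : Submodule K (MvPolynomial ι K)) ≤ M.comap (homogeneousComponent n) := by
    rw [← Algebra.top_toSubmodule, ← adjoin_centralForms (ρ := ρ) h2, Algebra.adjoin_eq_span,
      Submodule.span_le]
    intro m hm
    rw [SetLike.mem_coe, Submodule.mem_comap]
    rcases normalForm_cases hm with ⟨k, hk, hm⟩ | ⟨l₀, l₁, h, rfl⟩
    · rw [homogeneousComponent_of_mem hk]
      split_ifs with hkn
      · subst hkn; exact hodd m hk hm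
      · exact M.zero_mem
    · rw [homogeneousComponent_of_mem
        ((isHomogeneous_list_prod fun x hx => (h.left x hx).1.homog).mul
          (isHomogeneous_list_prod fun x hx => (h.right x hx).1.homog))]
      split_ifs with hkn
      · exact heven l₀ l₁ h hkn.symm
      · exact M.zero_mem
  have := key (Submodule.mem_top (x := p))
  rwa [Submodule.mem_comap, homogeneousComponent_of_mem hp, if_pos rfl] at this

end NormalForm

/-! ### Zero-sum subsequences and the upper bound for the Noether number -/

set_option maxRecDepth 10000 in
theorem exists_zero_sum_three : ∀ c₁ c₂ c₃ : Ch,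
    (c₁.2 = 0 ∨ c₁.2 = 2) → (c₂.2 = 0 ∨ c₂.2 = 2) → (c₃.2 = 0 ∨ c₃.2 = 2) →
    ∃ s : Finset (Fin 3), s.Nonempty ∧ ∑ i ∈ s, ![c₁, c₂, c₃] i = 0 := by
  decide

/-- A parametrization of the characters whose value at `b` has order four. -/
def oddCh (e : ZMod 2 × ZMod 2) : Ch := (e.1, 1 + 2 * (e.2.val : ZMod 4))

theorem exists_oddCh_eq : ∀ c : Ch, (c.2 = 1 ∨ c.2 = 3) → ∃ e, oddCh e = c := by
  decide

set_option maxRecDepth 100000 in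
set_option maxHeartbeats 2000000 in
theorem exists_zero_sum_five_oddCh : ∀ e₁ e₂ e₃ e₄ e₅ : ZMod 2 × ZMod 2,
    ∃ s : Finset (Fin 5), s.Nonempty ∧
      ∑ i ∈ s, ![oddCh e₁, oddCh e₂, oddCh e₃, oddCh e₄, oddCh e₅] i = 0 := by
  decide

section Upper

variable {K : Type*} [Field K] {ι : Type*} [Fintype ι] [DecidableEq ι]
variable {ρ : Representation K C4rtimesC4 (ι → K)} {I : K}

/-- The induction step for generating invariants: `B` contains the invariants of degree at most
`D` and the averages of the polynomials of degree less than `n`. -/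
structure Step (ρ : Representation K C4rtimesC4 (ι → K)) (B : Subalgebra K (MvPolynomial ι K))
    (D n : ℕ) : Prop where
  low : ∀ q ∈ invariants ρ, ∀ e ≤ D, q.IsHomogeneous e → q ∈ B
  ih : ∀ k < n, ∀ r : MvPolynomial ι K, r.IsHomogeneous k → reynolds ρ r ∈ B

namespace Step

variable {B : Subalgebra K (MvPolynomial ι K)} {D n : ℕ}

/-- If some of the semi-invariants `p i` have characters with sum zero, then their product is an
invariant of low degree that splits off from the average. -/
theorem reynolds_prod_mul_mem (h : Step ρ B D n) (hI : I ^ 2 = -1) {s : ℕ}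
    {p : Fin s → MvPolynomial ι K} {d : Fin s → ℕ} {c : Fin s → Ch}
    (hp : ∀ i, IsSemi ρ I (d i) (c i) (p i)) (hd : ∀ i, 1 ≤ d i) (hD : ∑ i, d i ≤ D)
    {r : MvPolynomial ι K} {k : ℕ} (hr : r.IsHomogeneous k) (hn : ∑ i, d i + k = n)
    {S : Finset (Fin s)} (hS : S.Nonempty) (hS0 : ∑ i ∈ S, c i = 0) :
    reynolds ρ ((∏ i, p i) * r) ∈ B := by
  have hq : IsSemi ρ I (∑ i ∈ S, d i) 0 (∏ i ∈ S, p i) := by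
    rw [← hS0]; exact IsSemi.prod hI S fun i _ => hp i
  have hrest := (IsSemi.prod hI Sᶜ fun i _ => hp i).homog.mul hr
  have hsum := Finset.sum_add_sum_compl S d
  have hpos : 1 ≤ ∑ i ∈ S, d i := by
    obtain ⟨i, hi⟩ := hS
    exact (hd i).trans (Finset.single_le_sum (fun _ _ => Nat.zero_le _) hi)
  rw [← Finset.prod_mul_prod_compl S p, mul_assoc, reynolds_mul_of_mem hq.mem_invariants]
  exact B.mul_mem (h.low _ hq.mem_invariants _ (by omega) hq.homog) (h.ih _ (by omega) _ hrest)

theorem reynolds_even_three_mem (h : Step ρ B D n) (hI : I ^ 2 = -1) (h2 : (2 : K) ≠ 0)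
    {x₁ x₂ x₃ r : MvPolynomial ι K} {d₁ d₂ d₃ k : ℕ} (h₁ : IsEven ρ 1 d₁ x₁)
    (h₂ : IsEven ρ 1 d₂ x₂) (h₃ : IsEven ρ 1 d₃ x₃) (hd₁ : 1 ≤ d₁) (hd₂ : 1 ≤ d₂) (hd₃ : 1 ≤ d₃)
    (hD : d₁ + d₂ + d₃ ≤ D) (hr : r.IsHomogeneous k) (hn : d₁ + d₂ + d₃ + k = n) :
    reynolds ρ (x₁ * (x₂ * (x₃ * r))) ∈ B := by
  rw [← Subalgebra.mem_toSubmodule, ← Submodule.mem_comap]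
  refine h₁.mul_mem_of_one hI h2 _ _ fun c₁ hc₁ q₁ hq₁ => ?_
  rw [mul_left_comm]
  refine h₂.mul_mem_of_one hI h2 _ _ fun c₂ hc₂ q₂ hq₂ => ?_
  rw [mul_left_comm q₁, mul_left_comm q₂]
  refine h₃.mul_mem_of_one hI h2 _ _ fun c₃ hc₃ q₃ hq₃ => ?_
  rw [Submodule.mem_comap, Subalgebra.mem_toSubmodule]
  obtain ⟨S, hS, hS0⟩ := exists_zero_sum_three c₁ c₂ c₃ hc₁ hc₂ hc₃
  have := h.reynolds_prod_mul_mem hI (p := ![q₁, q₂, q₃]) (d := ![d₁, d₂, d₃])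
    (c := ![c₁, c₂, c₃]) (by simp [Fin.forall_fin_succ, *]) (by simp [Fin.forall_fin_succ, *])
    (by simpa [Fin.sum_univ_succ, ← add_assoc] using hD) hr
    (by simpa [Fin.sum_univ_succ, ← add_assoc] using hn) hS hS0
  convert this using 2
  simp only [Fin.prod_univ_succ, Fin.prod_univ_zero, Matrix.cons_val_zero, Matrix.cons_val_succ]
  ring

theorem reynolds_odd_five_mem (h : Step ρ B D n) (hI : I ^ 2 = -1) (h2 : (2 : K) ≠ 0)
    {x₁ x₂ x₃ x₄ x₅ r : MvPolynomial ι K} {d₁ d₂ d₃ d₄ d₅ k : ℕ} (h₁ : IsEven ρ (-1) d₁ x₁)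
    (h₂ : IsEven ρ (-1) d₂ x₂) (h₃ : IsEven ρ (-1) d₃ x₃) (h₄ : IsEven ρ (-1) d₄ x₄)
    (h₅ : IsEven ρ (-1) d₅ x₅) (hd₁ : 1 ≤ d₁) (hd₂ : 1 ≤ d₂) (hd₃ : 1 ≤ d₃) (hd₄ : 1 ≤ d₄)
    (hd₅ : 1 ≤ d₅) (hD : d₁ + d₂ + d₃ + d₄ + d₅ ≤ D) (hr : r.IsHomogeneous k)
    (hn : d₁ + d₂ + d₃ + d₄ + d₅ + k = n) :
    reynolds ρ (x₁ * (x₂ * (x₃ * (x₄ * (x₅ * r))))) ∈ B := by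
  rw [← Subalgebra.mem_toSubmodule, ← Submodule.mem_comap]
  refine h₁.mul_mem_of_neg_one hI h2 _ _ fun c₁ hc₁ q₁ hq₁ => ?_
  rw [mul_left_comm]
  refine h₂.mul_mem_of_neg_one hI h2 _ _ fun c₂ hc₂ q₂ hq₂ => ?_
  rw [mul_left_comm q₁, mul_left_comm q₂]
  refine h₃.mul_mem_of_neg_one hI h2 _ _ fun c₃ hc₃ q₃ hq₃ => ?_
  rw [mul_left_comm q₁, mul_left_comm q₂, mul_left_comm q₃]
  refine h₄.mul_mem_of_neg_one hI h2 _ _ fun c₄ hc₄ q₄ hq₄ => ?_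
  rw [mul_left_comm q₁, mul_left_comm q₂, mul_left_comm q₃, mul_left_comm q₄]
  refine h₅.mul_mem_of_neg_one hI h2 _ _ fun c₅ hc₅ q₅ hq₅ => ?_
  rw [Submodule.mem_comap, Subalgebra.mem_toSubmodule]
  obtain ⟨e₁, rfl⟩ := exists_oddCh_eq c₁ hc₁
  obtain ⟨e₂, rfl⟩ := exists_oddCh_eq c₂ hc₂
  obtain ⟨e₃, rfl⟩ := exists_oddCh_eq c₃ hc₃
  obtain ⟨e₄, rfl⟩ := exists_oddCh_eq c₄ hc₄
  obtain ⟨e₅, rfl⟩ := exists_oddCh_eq c₅ hc₅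
  obtain ⟨S, hS, hS0⟩ := exists_zero_sum_five_oddCh e₁ e₂ e₃ e₄ e₅
  have := h.reynolds_prod_mul_mem hI (p := ![q₁, q₂, q₃, q₄, q₅]) (d := ![d₁, d₂, d₃, d₄, d₅])
    (c := ![oddCh e₁, oddCh e₂, oddCh e₃, oddCh e₄, oddCh e₅])
    (by simp [Fin.forall_fin_succ, *]) (by simp [Fin.forall_fin_succ, *])
    (by simpa [Fin.sum_univ_succ, ← add_assoc] using hD) hr
    (by simpa [Fin.sum_univ_succ, ← add_assoc] using hn) hS hS0
  convert this using 2
  simp only [Fin.prod_univ_succ, Fin.prod_univ_zero, Matrix.cons_val_zero, Matrix.cons_val_succ]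
  ring

/-- At least seven linear factors suffice: there are three even factors with `b ^ 2` acting
trivially (possibly after multiplying pairs on which it acts by `-1`), or five on which it acts
by `-1`. -/
theorem reynolds_evenLists_mem (h : Step ρ B 7 n) (hI : I ^ 2 = -1) (h2 : (2 : K) ≠ 0)
    {l₀ l₁ : List (MvPolynomial ι K × ℕ)} (hl : EvenLists ρ l₀ l₁)
    (hn : (l₀.map Prod.snd).sum + (l₁.map Prod.snd).sum = n) (h7 : 7 ≤ n) :
    reynolds ρ ((l₀.map Prod.fst).prod * (l₁.map Prod.fst).prod) ∈ B := by
  obtain ⟨hl₀, hl₁, ht⟩ := hl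
  have p₀ : ∀ l : List (MvPolynomial ι K × ℕ), (∀ x ∈ l, IsEven ρ 1 x.2 x.1 ∧ 1 ≤ x.2 ∧ x.2 ≤ 2) →
      (l.map Prod.fst).prod.IsHomogeneous (l.map Prod.snd).sum := fun l hl =>
    isHomogeneous_list_prod fun x hx => (hl x hx).1.homog
  have p₁ : ∀ l : List (MvPolynomial ι K × ℕ),
      (∀ x ∈ l, IsEven ρ (-1) x.2 x.1 ∧ 1 ≤ x.2 ∧ x.2 ≤ 2) →
      (l.map Prod.fst).prod.IsHomogeneous (l.map Prod.snd).sum := fun l hl =>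
    isHomogeneous_list_prod fun x hx => (hl x hx).1.homog
  have mul₁ : ∀ {x y : MvPolynomial ι K} {d e : ℕ}, IsEven ρ (-1) d x → IsEven ρ (-1) e y →
      IsEven ρ 1 (d + e) (x * y) := fun hx hy => by simpa using hx.mul hy
  match l₀, l₁ with
  | ⟨x₁, d₁⟩ :: ⟨x₂, d₂⟩ :: ⟨x₃, d₃⟩ :: l₀, l₁ =>
    simp only [List.forall_mem_cons, List.map_cons, List.sum_cons, List.prod_cons] at *
    obtain ⟨⟨e₁, _, _⟩, ⟨e₂, _, _⟩, ⟨e₃, _, _⟩, hl₀⟩ := hl₀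
    convert h.reynolds_even_three_mem hI h2 e₁ e₂ e₃ ‹_› ‹_› ‹_› (by omega)
      ((p₀ _ hl₀).mul (p₁ _ hl₁)) (by omega) using 2
    ring
  | [⟨x₁, d₁⟩, ⟨x₂, d₂⟩], ⟨y₁, f₁⟩ :: ⟨y₂, f₂⟩ :: l₁ =>
    simp only [List.forall_mem_cons, List.map_cons, List.sum_cons, List.prod_cons, List.map_nil,
      List.sum_nil, List.prod_nil, List.tail_cons] at *
    obtain ⟨⟨e₁, _, _⟩, ⟨e₂, _, _⟩, -⟩ := hl₀
    obtain ⟨⟨g₁, _, _⟩, ⟨g₂, _, _⟩, hl₁⟩ := hl₁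
    convert h.reynolds_even_three_mem hI h2 e₁ e₂ (mul₁ g₁ g₂) ‹_› ‹_› (by omega) (by omega)
      (p₁ _ hl₁) (by omega) using 2
    ring
  | [⟨x₁, d₁⟩], ⟨y₁, f₁⟩ :: ⟨y₂, f₂⟩ :: ⟨y₃, f₃⟩ :: ⟨y₄, f₄⟩ :: l₁ =>
    simp only [List.forall_mem_cons, List.map_cons, List.sum_cons, List.prod_cons, List.map_nil,
      List.sum_nil, List.prod_nil, List.tail_cons] at *
    obtain ⟨⟨e₁, _, _⟩, -⟩ := hl₀
    obtain ⟨⟨g₁, _, _⟩, ⟨g₂, _, _⟩, ⟨g₃, _, _⟩, ⟨g₄, _, _⟩, hl₁⟩ := hl₁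
    convert h.reynolds_even_three_mem hI h2 e₁ (mul₁ g₁ g₂) (mul₁ g₃ g₄) ‹_› (by omega)
      (by omega) (by omega) (p₁ _ hl₁) (by omega) using 2
    ring
  | [], ⟨y₁, f₁⟩ :: ⟨y₂, f₂⟩ :: ⟨y₃, f₃⟩ :: ⟨y₄, f₄⟩ :: ⟨y₅, f₅⟩ :: l₁ =>
    simp only [List.forall_mem_cons, List.map_cons, List.sum_cons, List.prod_cons, List.map_nil,
      List.sum_nil, List.prod_nil, List.tail_cons] at *
    obtain ⟨⟨g₁, _, _⟩, ⟨g₂, _, _⟩, ⟨g₃, _, _⟩, ⟨g₄, _, _⟩, ⟨g₅, _, _⟩, hl₁⟩ := hl₁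
    convert h.reynolds_odd_five_mem hI h2 g₁ g₂ g₃ g₄ g₅ ‹_› ‹_› ‹_› ‹_› ‹_› (by omega)
      (p₁ _ hl₁) (by omega) using 2
    ring
  | [_, _], [] | [_, _], [_] | [_], [] | [_], [_] | [_], [_, _] | [_], [_, _, _]
  | [], [] | [], [_] | [], [_, _] | [], [_, _, _] | [], [_, _, _, _] =>
    simp at hl₀ hl₁ ht hn
    omega

/-- If `a ^ 2` acts by `-1` then the average vanishes. -/
theorem reynolds_odd_mem (B : Subalgebra K (MvPolynomial ι K)) (h2 : (2 : K) ≠ 0)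
    {m : MvPolynomial ι K} (hm : act ρ (a ^ 2) m = -m) : reynolds ρ m ∈ B := by
  rw [reynolds_eq_zero_of_act_eq_smul (c := (-1 : K)) (by rw [hm, neg_one_smul])]
  · exact B.zero_mem
  · intro h
    apply h2
    linear_combination -h

end Step

theorem card_cast_ne_zero (h2 : (2 : K) ≠ 0) : (Fintype.card C4rtimesC4 : K) ≠ 0 := by
  rw [← Nat.card_eq_fintype_card, C4rtimesC4.card_eq]
  have : ((16 : ℕ) : K) = 2 ^ 4 := by norm_num
  rw [this]
  exact pow_ne_zero _ h2

/-- A subalgebra which contains the averages of all homogeneous polynomials contains all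
invariants. -/
theorem invariants_le_of_reynolds_mem (h2 : (2 : K) ≠ 0) {B : Subalgebra K (MvPolynomial ι K)}
    (h : ∀ n, ∀ p : MvPolynomial ι K, p.IsHomogeneous n → reynolds ρ p ∈ B) :
    invariants ρ ≤ B := by
  intro f hf
  rw [← reynolds_of_mem (card_cast_ne_zero h2) hf, ← sum_homogeneousComponent f, map_sum]
  exact B.sum_mem fun i _ => h i _ (homogeneousComponent_isHomogeneous i f)

theorem betaRep_le_seven (ρ : Representation K C4rtimesC4 (ι → K)) (hI : I ^ 2 = -1)
    (h2 : (2 : K) ≠ 0) : betaRep ρ ≤ 7 := by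
  have hle : Algebra.adjoin K (invariantsLE ρ 7) = invariants ρ := by
    refine le_antisymm (Algebra.adjoin_le fun f hf => hf.1) (invariants_le_of_reynolds_mem h2 ?_)
    have low : ∀ q ∈ invariants ρ, ∀ e ≤ 7, q.IsHomogeneous e →
        q ∈ Algebra.adjoin K (invariantsLE ρ 7) := fun q hq e he hqe =>
      Algebra.subset_adjoin ⟨hq, hqe.totalDegree_le.trans he⟩
    intro n
    induction n using Nat.strong_induction_on with
    | _ n ih =>
      intro p hp
      rcases le_or_gt n 7 with hn | hn
      · exact low _ (reynolds_mem ρ p) n hn (isHomogeneous_reynolds hp)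
      · exact mem_of_normalForm h2 hp ((Algebra.adjoin K (invariantsLE ρ 7)).toSubmodule.comap
          (reynolds ρ)) (fun m _ hm => Submodule.mem_comap.2
            (Step.reynolds_odd_mem (Algebra.adjoin K (invariantsLE ρ 7)) h2 hm))
          fun l₀ l₁ hl hln => Step.reynolds_evenLists_mem ⟨low, ih⟩ hI h2 hl hln hn.le
  exact iInf_le (fun d : {d : ℕ // Algebra.adjoin K (invariantsLE ρ d) = invariants ρ} =>
    ((d : ℕ) : ℕ∞)) ⟨7, hle⟩

end Upper
end NoetherNumber

namespace NoetherNumber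

open MvPolynomial C4rtimesC4

/-! ### The upper bound for the separating Noether number -/

section Separating

variable {K : Type*} [Field K] {ι : Type*} [Fintype ι] [DecidableEq ι]
variable {ρ : Representation K C4rtimesC4 (ι → K)} {I : K} {v w : ι → K}

/-- The algebra of polynomials taking the same value at `v` and `w`. -/
noncomputable def agree (v w : ι → K) : Subalgebra K (MvPolynomial ι K) :=
  AlgHom.equalizer (aeval v) (aeval w)

omit [Fintype ι] [DecidableEq ι] in
theorem mem_agree {f : MvPolynomial ι K} : f ∈ agree v w ↔ eval v f = eval w f := by
  simp [agree, AlgHom.mem_equalizer, aeval_eq_eval]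

omit [Fintype ι] [DecidableEq ι] in
theorem mem_agree_of_mul_mem {f g : MvPolynomial ι K} (hg : g ∈ agree v w) (hg0 : eval v g ≠ 0)
    (hfg : f * g ∈ agree v w) : f ∈ agree v w := by
  rw [mem_agree] at *
  rw [map_mul, map_mul, ← hg] at hfg
  exact mul_right_cancel₀ hg0 hfg

theorem IsSemi.exists_act_eq_smul {d : ℕ} {c : Ch} {p : MvPolynomial ι K}
    (h : IsSemi ρ I d c p) (g : C4rtimesC4) : ∃ μ : K, act ρ g p = μ • p := by
  obtain ⟨i, j, rfl⟩ := eq_pow_mul_pow g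
  rw [← act_act, act_pow_of_act_eq_smul h.act_b, map_smul, act_pow_of_act_eq_smul h.act_a,
    smul_smul]
  exact ⟨_, rfl⟩

theorem IsSemi.eval_reynolds_mul_eq_zero {d : ℕ} {c : Ch} {p : MvPolynomial ι K}
    (h : IsSemi ρ I d c p) (hv : eval v p = 0) (r : MvPolynomial ι K) :
    eval v (reynolds ρ (p * r)) = 0 := by
  rw [reynolds_apply, smul_eval, map_sum, Finset.sum_eq_zero, mul_zero]
  intro g _
  obtain ⟨μ, hμ⟩ := h.exists_act_eq_smul g
  rw [map_mul, hμ, map_mul, smul_eval, hv, mul_zero, zero_mul]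

/-- If the linear semi-invariants nontrivial on `b ^ 2` vanish at `v` and `w`, then only the
factors on which `b ^ 2` acts trivially matter, and a product of three of these has an invariant
factor, of degree at most six. -/
theorem invariants_le_agree_of_vanishing (hI : I ^ 2 = -1) (h2 : (2 : K) ≠ 0)
    (low : ∀ q ∈ invariants ρ, ∀ e ≤ 6, q.IsHomogeneous e → q ∈ agree v w)
    (h0 : ∀ c : Ch, (c.2 = 1 ∨ c.2 = 3) → ∀ t, IsSemi ρ I 1 c t → eval v t = 0 ∧ eval w t = 0) :
    invariants ρ ≤ agree v w := by
  refine invariants_le_of_reynolds_mem h2 fun n => ?_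
  induction n using Nat.strong_induction_on with
  | _ n ih =>
    intro p hp
    have step : Step ρ (agree v w) 6 n := ⟨low, ih⟩
    refine mem_of_normalForm h2 hp ((agree v w).toSubmodule.comap (reynolds ρ))
      (fun m _ hm => Submodule.mem_comap.2 (Step.reynolds_odd_mem (agree v w) h2 hm)) ?_
    intro l₀ l₁ hl hln
    rw [Submodule.mem_comap, Subalgebra.mem_toSubmodule]
    obtain ⟨hl₀, hl₁, ht⟩ := hl
    match l₁ with
    | ⟨y₁, f₁⟩ :: ⟨y₂, f₂⟩ :: l₁ =>
      simp only [List.forall_mem_cons, List.map_cons, List.prod_cons, List.tail_cons] at *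
      obtain ⟨-, ⟨e₂, -, -⟩, -⟩ := hl₁
      obtain ⟨rfl, -⟩ := ht
      rw [mul_left_comm y₁, mul_left_comm _ y₂, ← Subalgebra.mem_toSubmodule,
        ← Submodule.mem_comap]
      refine e₂.mul_mem_of_neg_one hI h2 _ _ fun c hc q hq => ?_
      rw [Submodule.mem_comap, Subalgebra.mem_toSubmodule, mem_agree,
        hq.eval_reynolds_mul_eq_zero (h0 c hc q hq).1, hq.eval_reynolds_mul_eq_zero (h0 c hc q hq).2]
    | [⟨y, f⟩] =>
      simp only [List.forall_mem_cons, List.map_cons, List.prod_cons, List.map_nil,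
        List.prod_nil, mul_one] at *
      have hb : act ρ (b ^ 2) ((l₀.map Prod.fst).prod * y) =
          (-1 : K) • ((l₀.map Prod.fst).prod * y) := by
        rw [map_mul, hl₁.1.1.act_bb, act_list_prod_eq, mul_smul_comm]
        intro x hx
        rw [(hl₀ x hx).1.act_bb, one_smul]
      rw [reynolds_eq_zero_of_act_eq_smul hb]
      · exact (agree v w).zero_mem
      · intro h
        exact h2 (by linear_combination -h)
    | [] =>
      simp only [List.map_nil, List.prod_nil, List.sum_nil, mul_one, add_zero] at *
      match l₀ with
      | ⟨x₁, d₁⟩ :: ⟨x₂, d₂⟩ :: ⟨x₃, d₃⟩ :: l₀ =>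
        simp only [List.forall_mem_cons, List.map_cons, List.sum_cons, List.prod_cons] at *
        obtain ⟨⟨e₁, _, _⟩, ⟨e₂, _, _⟩, ⟨e₃, _, _⟩, hl₀⟩ := hl₀
        exact step.reynolds_even_three_mem hI h2 e₁ e₂ e₃ ‹_› ‹_› ‹_› (by omega)
          (isHomogeneous_list_prod fun x hx => (hl₀ x hx).1.homog) (by omega)
      | [] | [_] | [_, _] =>
        have hh := isHomogeneous_list_prod fun x hx => (hl₀ x hx).1.homog
        refine low _ (reynolds_mem ρ _) _ ?_ (isHomogeneous_reynolds hh)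
        simp at hl₀ ⊢
        try omega

/-- A generator of the kernel of the character `c`, if the value of `c` at `b` has order four. -/
def kerGen (c : Ch) : C4rtimesC4 := if c.1 = 0 then a else a * b ^ 2

theorem kerGen_sq (c : Ch) : kerGen c ^ 2 = a ^ 2 := by
  unfold kerGen; split_ifs <;> decide

theorem kerGen_mul_b (c : Ch) : kerGen c * b = b * kerGen c ^ 3 := by
  unfold kerGen; split_ifs <;> decide

theorem bb_mul_kerGen (c : Ch) : b ^ 2 * kerGen c = kerGen c * b ^ 2 := by
  unfold kerGen; split_ifs <;> decide

/-- The exponent of the sign by which `kerGen c` acts on the semi-invariants of character `c'`. -/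
def kerSign (c c' : Ch) : ℕ := if c.1 = 0 then c'.1.val else c'.1.val + c'.2.val

theorem IsSemi.act_kerGen (hI : I ^ 2 = -1) {d : ℕ} {c' : Ch} {p : MvPolynomial ι K}
    (h : IsSemi ρ I d c' p) (c : Ch) : act ρ (kerGen c) p = (-1 : K) ^ kerSign c c' • p := by
  unfold kerGen kerSign
  split_ifs
  · exact h.act_a
  · rw [← act_act, act_pow_of_act_eq_smul h.act_b, map_smul, h.act_a, smul_smul, ← pow_mul,
      mul_comm c'.2.val, pow_mul, hI, ← pow_add, add_comm]

theorem exists_nsmul_add_eq_zero : ∀ c c' : Ch, (c.2 = 1 ∨ c.2 = 3) → kerSign c c' % 2 = 0 →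
    ∃ j : Fin 4, c' + (j : ℕ) • c = 0 := by
  decide

theorem exists_nsmul_add_eq_zero_of_even : ∀ c c' : Ch, (c.2 = 1 ∨ c.2 = 3) →
    (c'.2 = 0 ∨ c'.2 = 2) → kerSign c c' % 2 = 0 → ∃ j : Fin 3, c' + (j : ℕ) • c = 0 := by
  decide

theorem exists_two_nsmul_add_eq_zero : ∀ c c' : Ch, (c.2 = 1 ∨ c.2 = 3) →
    ∃ j : Fin 3, 2 • c' + (j : ℕ) • c = 0 := by
  decide

set_option maxRecDepth 10000 in
theorem exists_nsmul_add_nsmul_add_eq_zero : ∀ c c' c'' : Ch, (c.2 = 1 ∨ c.2 = 3) →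
    kerSign c c' % 2 = 1 →
    ∃ i j : Fin 5, (i : ℕ) + j ≤ 4 ∧ c'' + ((i : ℕ) • c + (j : ℕ) • c') = 0 := by
  decide

variable (ρ I v w) in
/-- Two points `v` and `w` at which the invariants of degree at most six agree, together with a
linear semi-invariant `t`, whose character `c` has a value of order four at `b`, and which takes
the same nonzero value at both points. -/
structure Anchor (c : Ch) (t : MvPolynomial ι K) : Prop where
  low : ∀ q ∈ invariants ρ, ∀ e ≤ 6, q.IsHomogeneous e → q ∈ agree v w
  ch : c.2 = 1 ∨ c.2 = 3
  semi : IsSemi ρ I 1 c t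
  mem : t ∈ agree v w
  ne_zero : eval v t ≠ 0

namespace Anchor

variable {c : Ch} {t : MvPolynomial ι K}

/-- A semi-invariant which becomes an invariant of degree at most six after multiplication by a
power of `t` takes the same value at `v` and `w`. -/
theorem semi_mem (h : Anchor ρ I v w c t) (hI : I ^ 2 = -1) {d : ℕ} {c' : Ch}
    {q : MvPolynomial ι K} (hq : IsSemi ρ I d c' q) {j : ℕ} (hj : c' + j • c = 0)
    (hd : d + j ≤ 6) : q ∈ agree v w := by
  refine mem_agree_of_mul_mem (pow_mem h.mem j) (by rw [map_pow]; exact pow_ne_zero _ h.ne_zero) ?_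
  have := hq.mul hI (h.semi.pow hI j)
  rw [hj, mul_one] at this
  exact h.low _ this.mem_invariants _ hd this.homog

/-- A second linear semi-invariant, nonzero at `v` and `w`, with character not a multiple of `c`:
every semi-invariant of degree at most two can be completed to an invariant of degree at most
six by a monomial in `t` and `t'`. -/
theorem semi_mem_of_two (h : Anchor ρ I v w c t) (hI : I ^ 2 = -1) {c' : Ch}
    {t' : MvPolynomial ι K} (ht' : IsSemi ρ I 1 c' t') (hcc' : kerSign c c' % 2 = 1)
    (ht'm : t' ∈ agree v w) (ht'0 : eval v t' ≠ 0) {d : ℕ} {c'' : Ch}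
    {q : MvPolynomial ι K} (hq : IsSemi ρ I d c'' q) (hd : d ≤ 2) : q ∈ agree v w := by
  obtain ⟨i, j, hij, h0⟩ := exists_nsmul_add_nsmul_add_eq_zero c c' c'' h.ch hcc'
  refine mem_agree_of_mul_mem (mul_mem (pow_mem h.mem i) (pow_mem ht'm j)) ?_ ?_
  · rw [map_mul, map_pow, map_pow]
    exact mul_ne_zero (pow_ne_zero _ h.ne_zero) (pow_ne_zero _ ht'0)
  · have := hq.mul hI ((h.semi.pow hI i).mul hI (ht'.pow hI j))
    rw [h0] at this
    exact h.low _ this.mem_invariants _ (by omega) this.homog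

theorem invariants_le_agree_of_two (h : Anchor ρ I v w c t) (hI : I ^ 2 = -1) (h2 : (2 : K) ≠ 0)
    {c' : Ch} {t' : MvPolynomial ι K} (ht' : IsSemi ρ I 1 c' t') (hcc' : kerSign c c' % 2 = 1)
    (ht'm : t' ∈ agree v w) (ht'0 : eval v t' ≠ 0) : invariants ρ ≤ agree v w := by
  have semi : ∀ {d : ℕ} {c'' : Ch} {q : MvPolynomial ι K}, IsSemi ρ I d c'' q → d ≤ 2 →
      q ∈ agree v w := fun hq hd => h.semi_mem_of_two hI ht' hcc' ht'm ht'0 hq hd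
  refine invariants_le_of_reynolds_mem h2 fun n p hp => ?_
  -- Averaging over `a ^ 2` removes the products with an odd number of odd factors.
  have key : reynolds ρ p ∈ (agree v w).toSubmodule.comap
      (LinearMap.id + (act ρ (a ^ 2)).toLinearMap) := by
    refine mem_of_normalForm (ρ := ρ) h2 (isHomogeneous_reynolds hp) _ (fun m _ hm => ?_)
      fun l₀ l₁ hl hln => ?_
    · simp [hm]
    · have hmem : (l₀.map Prod.fst).prod * (l₁.map Prod.fst).prod ∈ agree v w := by
        refine mul_mem (list_prod_mem ?_) (list_prod_mem ?_)
        · simp only [List.mem_map]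
          rintro _ ⟨x, hx, rfl⟩
          obtain ⟨hx1, -, hx2⟩ := hl.left x hx
          simpa using hx1.mul_mem_of_one hI h2 1 (agree v w).toSubmodule
            fun c hc q hq => by simpa using semi hq hx2
        · simp only [List.mem_map]
          rintro _ ⟨x, hx, rfl⟩
          obtain ⟨hx1, -, hx2⟩ := hl.right x hx
          simpa using hx1.mul_mem_of_neg_one hI h2 1 (agree v w).toSubmodule
            fun c hc q hq => by simpa using semi hq hx2
      have h3 : act ρ (a ^ 2) ((l₀.map Prod.fst).prod * (l₁.map Prod.fst).prod) =
          (l₀.map Prod.fst).prod * (l₁.map Prod.fst).prod := by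
        rw [map_mul, act_list_prod_eq fun x hx => (hl.left x hx).1.act_aa,
          act_list_prod_eq fun x hx => (hl.right x hx).1.act_aa]
      simpa [h3] using add_mem hmem hmem
  simp only [Submodule.mem_comap, LinearMap.add_apply, LinearMap.id_apply,
    AlgHom.toLinearMap_apply, reynolds_mem ρ p (a ^ 2), Subalgebra.mem_toSubmodule] at key
  have := Subalgebra.smul_mem _ key ((2 : K)⁻¹)
  rwa [← two_smul K, smul_smul, inv_mul_cancel₀ h2, one_smul] at this

end Anchor

end Separating
end NoetherNumber

namespace NoetherNumber

open MvPolynomial C4rtimesC4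

section SeparatingOneCharacter

variable {K : Type*} [Field K] {ι : Type*} [Fintype ι] [DecidableEq ι]
variable {ρ : Representation K C4rtimesC4 (ι → K)} {I : K} {v w : ι → K}

/-- Linear forms on which `g` acts by the scalar `s` and `b ^ 2` by the scalar `σ`. -/
structure IsEigen (ρ : Representation K C4rtimesC4 (ι → K)) (g : C4rtimesC4) (s σ : K)
    (p : MvPolynomial ι K) : Prop where
  homog : p.IsHomogeneous 1
  act_g : act ρ g p = s • p
  act_bb : act ρ (b ^ 2) p = σ • p

theorem IsEigen.act_b {c : Ch} {s σ : K} {p : MvPolynomial ι K} (hs : s ^ 2 = -1)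
    (h : IsEigen ρ (kerGen c) s σ p) : IsEigen ρ (kerGen c) (-s) σ (act ρ b p) where
  homog := isHomogeneous_act h.homog b
  act_g := by
    rw [act_act, kerGen_mul_b, ← act_act, act_pow_of_act_eq_smul h.act_g, map_smul, pow_succ, hs,
      neg_one_mul]
  act_bb := by
    rw [act_act, show b ^ 2 * b = b * b ^ 2 by decide, ← act_act, h.act_bb, map_smul]

namespace Anchor

variable {c : Ch} {t : MvPolynomial ι K}

/-- Membership of a polynomial fixed by `g = kerGen c` in `agree v w` can be tested on the larger
subspace of all `p` with `p + g p ∈ agree v w`. This subspace contains all semi-invariants on which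
`g` acts by `-1`, so that only those fixed by `g` have to be considered. -/
theorem fixed_mem_of_le (h2 : (2 : K) ≠ 0)
    {p : MvPolynomial ι K} (hg : act ρ (kerGen c) p = p)
    (hp : p ∈ (agree v w).toSubmodule.comap
      (LinearMap.id + (act ρ (kerGen c)).toLinearMap)) : p ∈ agree v w := by
  simp only [Submodule.mem_comap, LinearMap.add_apply, LinearMap.id_apply,
    AlgHom.toLinearMap_apply, hg, Subalgebra.mem_toSubmodule] at hp
  have := Subalgebra.smul_mem _ hp ((2 : K)⁻¹)
  rwa [← two_smul K, smul_smul, inv_mul_cancel₀ h2, one_smul] at this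

theorem semi_mem_comap (hI : I ^ 2 = -1) {d : ℕ} {c' : Ch} {q : MvPolynomial ι K}
    (hq : IsSemi ρ I d c' q) (h : kerSign c c' % 2 = 0 → q ∈ agree v w) :
    q * 1 ∈ (agree v w).toSubmodule.comap
      (LinearMap.id + (act ρ (kerGen c)).toLinearMap) := by
  rw [mul_one, Submodule.mem_comap, LinearMap.add_apply, LinearMap.id_apply,
    AlgHom.toLinearMap_apply, hq.act_kerGen hI, Subalgebra.mem_toSubmodule]
  rcases Nat.mod_two_eq_zero_or_one (kerSign c c') with h0 | h1
  · exact add_mem (h h0) (Subalgebra.smul_mem _ (h h0) _)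
  · rw [(Nat.odd_iff.2 h1).neg_one_pow, neg_one_smul, add_neg_cancel]
    exact zero_mem _

theorem fixed_mem_of_one (h : Anchor ρ I v w c t) (hI : I ^ 2 = -1) (h2 : (2 : K) ≠ 0) {d : ℕ}
    {p : MvPolynomial ι K} (hp : IsEven ρ 1 d p) (hg : act ρ (kerGen c) p = p) (hd : d ≤ 4) :
    p ∈ agree v w := by
  refine fixed_mem_of_le h2 hg ?_
  rw [← mul_one p]
  refine hp.mul_mem_of_one hI h2 1 _ fun c' hc' q hq => semi_mem_comap hI hq fun h0 => ?_
  obtain ⟨j, hj⟩ := exists_nsmul_add_eq_zero_of_even c c' h.ch hc' h0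
  exact h.semi_mem hI hq hj (by omega)

theorem fixed_mem_of_neg_one (h : Anchor ρ I v w c t) (hI : I ^ 2 = -1) (h2 : (2 : K) ≠ 0) {d : ℕ}
    {p : MvPolynomial ι K} (hp : IsEven ρ (-1) d p) (hg : act ρ (kerGen c) p = p) (hd : d ≤ 3) :
    p ∈ agree v w := by
  refine fixed_mem_of_le h2 hg ?_
  rw [← mul_one p]
  refine hp.mul_mem_of_neg_one hI h2 1 _ fun c' hc' q hq => semi_mem_comap hI hq fun h0 => ?_
  obtain ⟨j, hj⟩ := exists_nsmul_add_eq_zero c c' h.ch h0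
  exact h.semi_mem hI hq hj (by omega)

theorem pair_mem (h : Anchor ρ I v w c t) (hI : I ^ 2 = -1) (h2 : (2 : K) ≠ 0)
    {s σ σ' : K} (hs : s ^ 2 = -1) (hσ : σ = 1 ∨ σ = -1) (hσ' : σ' = 1 ∨ σ' = -1)
    {p q : MvPolynomial ι K} (hp : IsEigen ρ (kerGen c) s σ p)
    (hq : IsEigen ρ (kerGen c) (-s) σ' q) : p * q ∈ agree v w := by
  have hg : act ρ (kerGen c) (p * q) = p * q := by
    rw [map_mul, hp.act_g, hq.act_g, smul_mul_smul_comm, mul_neg, ← sq, hs, neg_neg, one_smul]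
  have hE : IsEven ρ (σ * σ') 2 (p * q) :=
    ⟨hp.homog.mul hq.homog, by rw [← kerGen_sq c, sq, ← act_act, hg, hg],
      by rw [map_mul, hp.act_bb, hq.act_bb, smul_mul_smul_comm]⟩
  have : σ * σ' = 1 ∨ σ * σ' = -1 := by
    rcases hσ with rfl | rfl <;> rcases hσ' with rfl | rfl <;> simp
  rcases this with h1 | h1 <;> rw [h1] at hE
  · exact h.fixed_mem_of_one hI h2 hE hg (by norm_num)
  · exact h.fixed_mem_of_neg_one hI h2 hE hg (by norm_num)

theorem act_kerGen_quad {s σ₁ σ₂ σ₃ σ₄ : K} (hs : s ^ 2 = -1) {p₁ p₂ p₃ p₄ : MvPolynomial ι K}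
    (h₁ : IsEigen ρ (kerGen c) s σ₁ p₁) (h₂ : IsEigen ρ (kerGen c) s σ₂ p₂)
    (h₃ : IsEigen ρ (kerGen c) s σ₃ p₃) (h₄ : IsEigen ρ (kerGen c) s σ₄ p₄) :
    act ρ (kerGen c) (p₁ * p₂ * p₃ * p₄) = p₁ * p₂ * p₃ * p₄ ∧
      IsEven ρ (σ₁ * σ₂ * σ₃ * σ₄) 4 (p₁ * p₂ * p₃ * p₄) := by
  have hg : act ρ (kerGen c) (p₁ * p₂ * p₃ * p₄) = p₁ * p₂ * p₃ * p₄ := by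
    rw [map_mul, map_mul, map_mul, h₁.act_g, h₂.act_g, h₃.act_g, h₄.act_g]
    simp only [smul_mul_smul_comm]
    rw [show s * s * s * s = (s ^ 2) ^ 2 by ring, hs]
    simp
  refine ⟨hg, ((h₁.homog.mul h₂.homog).mul h₃.homog).mul h₄.homog, ?_, ?_⟩
  · rw [← kerGen_sq c, sq, ← act_act, hg, hg]
  · rw [map_mul, map_mul, map_mul, h₁.act_bb, h₂.act_bb, h₃.act_bb, h₄.act_bb]
    simp only [smul_mul_smul_comm]

theorem quad_mem_of_prod_eq_one (h : Anchor ρ I v w c t) (hI : I ^ 2 = -1) (h2 : (2 : K) ≠ 0)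
    {s σ₁ σ₂ σ₃ σ₄ : K} (hs : s ^ 2 = -1) {p₁ p₂ p₃ p₄ : MvPolynomial ι K}
    (h₁ : IsEigen ρ (kerGen c) s σ₁ p₁) (h₂ : IsEigen ρ (kerGen c) s σ₂ p₂)
    (h₃ : IsEigen ρ (kerGen c) s σ₃ p₃) (h₄ : IsEigen ρ (kerGen c) s σ₄ p₄)
    (hσ : σ₁ * σ₂ * σ₃ * σ₄ = 1) : p₁ * p₂ * p₃ * p₄ ∈ agree v w := by
  obtain ⟨hg, hE⟩ := act_kerGen_quad hs h₁ h₂ h₃ h₄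
  rw [hσ] at hE
  exact h.fixed_mem_of_one hI h2 hE hg le_rfl

/-- If `b ^ 2` acts by `-1` on `X` then one of `X + I b X` and `X - I b X` is a semi-invariant
of character `-c`, and can be completed to an invariant by `t` alone. -/
theorem exists_add_smul_act_b_mem (h : Anchor ρ I v w c t) (hI : I ^ 2 = -1)
    {X : MvPolynomial ι K} (hX : IsEven ρ (-1) 4 X) (hg : act ρ (kerGen c) X = X) :
    ∃ l : K, X + l • act ρ b X ∈ agree v w := by
  set c' : Ch := -c with hc'
  have hl : I ^ c'.2.val * I ^ c'.2.val = -1 := by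
    rw [← pow_add, ← two_mul, pow_mul, hI]
    have : c'.2.val % 2 = 1 := by
      rcases h.ch with h | h <;> rw [hc', Prod.snd_neg, h] <;> decide
    exact (Nat.odd_iff.2 this).neg_one_pow
  set l : K := -I ^ c'.2.val with hl'
  refine ⟨l, ?_⟩
  set Z := X + l • act ρ b X with hZ
  have hbX : act ρ b (act ρ b X) = -X := by
    rw [act_act, ← sq, hX.act_bb, neg_one_smul]
  have hgY : act ρ (kerGen c) (act ρ b X) = act ρ b X := by
    rw [act_act, kerGen_mul_b, ← act_act]
    congr 1
    rw [act_pow_of_act_eq_smul (μ := (1 : K)) (by rw [hg, one_smul]), one_pow, one_smul]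
  have hgZ : act ρ (kerGen c) Z = Z := by rw [hZ, map_add, map_smul, hg, hgY]
  have hbbZ : act ρ (b ^ 2) Z = -Z := by
    rw [hZ, map_add, map_smul, hX.act_bb, act_act, show b ^ 2 * b = b * b ^ 2 by decide,
      ← act_act, hX.act_bb, map_smul]
    module
  have hsemi : IsSemi ρ I 4 c' Z := by
    refine ⟨hX.homog.add ((homogeneousSubmodule ι K 4).smul_mem _ (isHomogeneous_act hX.homog b)),
      ?_, ?_⟩
    · have hc1 : c.1 = 0 ∨ c.1 = 1 := by
        generalize c.1 = x; revert x; decide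
      rcases hc1 with h1 | h1
      · have : kerGen c = a := by simp [kerGen, h1]
        rw [this] at hgZ
        rw [hgZ, hc', Prod.fst_neg, h1]; simp
      · have : a = kerGen c * b ^ 2 := by
          simp only [kerGen, h1, one_ne_zero, if_false]; decide
        rw [this, ← act_act, hbbZ, map_neg, hgZ, hc', Prod.fst_neg, h1]
        simp [show (-1 : ZMod 2) = 1 from by decide, show ZMod.val (1 : ZMod 2) = 1 from rfl]
    · rw [hZ, map_add, map_smul, hbX, smul_add, smul_smul,
        show I ^ c'.2.val * l = 1 by rw [hl', mul_neg, hl, neg_neg], hl']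
      module
  exact h.semi_mem hI hsemi (j := 1) (by rw [hc', one_smul, neg_add_cancel]) (by norm_num)

/-- The crucial case: four eigenvectors for the same eigenvalue of `kerGen c`, one of them of
different type. The value of `X = p₁ p₂ p₃ q` is obtained from the identity
`X * (p₁ * b q) = (p₁ p₂ p₃ p₁) * (q * b q)`, or, if this degenerates, from the value of
`X ± I b X`. -/
theorem quad_mem_of_three (h : Anchor ρ I v w c t) (hI : I ^ 2 = -1) (h2 : (2 : K) ≠ 0)
    {s σ σ' : K} (hs : s ^ 2 = -1) (hσ : σ = 1 ∨ σ = -1) (hσ' : σ' = -σ)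
    {p₁ p₂ p₃ q : MvPolynomial ι K}
    (h₁ : IsEigen ρ (kerGen c) s σ p₁) (h₂ : IsEigen ρ (kerGen c) s σ p₂)
    (h₃ : IsEigen ρ (kerGen c) s σ p₃) (hq : IsEigen ρ (kerGen c) s σ' q) :
    p₁ * p₂ * p₃ * q ∈ agree v w := by
  have hs' : (-s) ^ 2 = -1 := by rw [neg_sq, hs]
  have hσ4 : σ * σ * σ * σ = 1 := by rcases hσ with rfl | rfl <;> ring
  have hσ'4 : σ' * σ' * σ' * σ' = 1 := by rw [hσ']; linear_combination hσ4
  have hσ3 : σ * σ * σ * σ' = -1 := by rw [hσ']; linear_combination -hσ4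
  have hσ'1 : σ' = 1 ∨ σ' = -1 := by rcases hσ with rfl | rfl <;> simp [hσ']
  obtain ⟨hgX, hEX⟩ := act_kerGen_quad hs h₁ h₂ h₃ hq
  rw [hσ3] at hEX
  obtain ⟨l, hl⟩ := h.exists_add_smul_act_b_mem hI hEX hgX
  have hq' := hq.act_b hs
  have hpq := h.pair_mem hI h2 hs hσ hσ'1 h₁ hq'
  have hqq := h.pair_mem hI h2 hs hσ'1 hσ'1 hq hq'
  have hppp := h.quad_mem_of_prod_eq_one hI h2 hs h₁ h₂ h₃ h₁ hσ4
  have hp4 := h.quad_mem_of_prod_eq_one hI h2 hs h₁ h₁ h₁ h₁ hσ4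
  have hq4 := h.quad_mem_of_prod_eq_one hI h2 hs' hq' hq' hq' hq' hσ'4
  -- `p₁` vanishes at `v` if and only if it vanishes at `w`, and likewise for `b q`.
  have zero_iff : ∀ {f : MvPolynomial ι K}, f * f * f * f ∈ agree v w → eval v f = 0 →
      eval w f = 0 := by
    intro f hf hf0
    rw [mem_agree] at hf
    simpa [hf0] using hf.symm
  by_cases h0 : eval v (p₁ * act ρ b q) = 0
  · rw [map_mul, mul_eq_zero] at h0
    rcases h0 with h0 | h0
    · have h0' := zero_iff hp4 h0
      rw [mem_agree]
      simp [h0, h0']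
    · have h0' := zero_iff hq4 h0
      rw [mem_agree] at hl ⊢
      rw [map_add, map_add, smul_eval, smul_eval, map_mul (act ρ b), map_mul (eval v) _ (act ρ b q),
        map_mul (eval w) _ (act ρ b q), h0, h0'] at hl
      simpa using hl
  · refine mem_agree_of_mul_mem hpq h0 ?_
    convert mul_mem hppp hqq using 1
    ring

theorem quad_mem (h : Anchor ρ I v w c t) (hI : I ^ 2 = -1) (h2 : (2 : K) ≠ 0)
    {s σ₁ σ₂ σ₃ σ₄ : K} (hs : s ^ 2 = -1) (hσ₁ : σ₁ = 1 ∨ σ₁ = -1) (hσ₂ : σ₂ = 1 ∨ σ₂ = -1)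
    (hσ₃ : σ₃ = 1 ∨ σ₃ = -1) (hσ₄ : σ₄ = 1 ∨ σ₄ = -1) {p₁ p₂ p₃ p₄ : MvPolynomial ι K}
    (h₁ : IsEigen ρ (kerGen c) s σ₁ p₁) (h₂ : IsEigen ρ (kerGen c) s σ₂ p₂)
    (h₃ : IsEigen ρ (kerGen c) s σ₃ p₃) (h₄ : IsEigen ρ (kerGen c) s σ₄ p₄) :
    p₁ * p₂ * p₃ * p₄ ∈ agree v w := by
  have key : ∀ {σ σ' : K} {q₁ q₂ q₃ q₄ : MvPolynomial ι K}, (σ = 1 ∨ σ = -1) → (σ' = -σ) →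
      IsEigen ρ (kerGen c) s σ q₁ → IsEigen ρ (kerGen c) s σ q₂ → IsEigen ρ (kerGen c) s σ q₃ →
      IsEigen ρ (kerGen c) s σ' q₄ → q₁ * q₂ * q₃ * q₄ = p₁ * p₂ * p₃ * p₄ →
      p₁ * p₂ * p₃ * p₄ ∈ agree v w := fun hσ hσ' g₁ g₂ g₃ g₄ e =>
    e ▸ h.quad_mem_of_three hI h2 hs hσ hσ' g₁ g₂ g₃ g₄
  rcases hσ₁ with rfl | rfl <;> rcases hσ₂ with rfl | rfl <;> rcases hσ₃ with rfl | rfl <;>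
    rcases hσ₄ with rfl | rfl <;>
    first
    | exact h.quad_mem_of_prod_eq_one hI h2 hs h₁ h₂ h₃ h₄ (by ring1)
    | exact key (by simp) (by simp) h₁ h₂ h₃ h₄ (by ring1)
    | exact key (by simp) (by simp) h₁ h₂ h₄ h₃ (by ring1)
    | exact key (by simp) (by simp) h₁ h₃ h₄ h₂ (by ring1)
    | exact key (by simp) (by simp) h₂ h₃ h₄ h₁ (by ring1)

/-- Every product of eigenvectors of `kerGen c` that is fixed by `kerGen c` has the same value at
`v` and `w`: split off pairs of opposite eigenvalues and quadruples of equal ones. -/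
theorem list_prod_mem (h : Anchor ρ I v w c t) (hI : I ^ 2 = -1) (h2 : (2 : K) ≠ 0) :
    ∀ P N : List (MvPolynomial ι K),
      (∀ p ∈ P, ∃ σ : K, (σ = 1 ∨ σ = -1) ∧ IsEigen ρ (kerGen c) I σ p) →
      (∀ p ∈ N, ∃ σ : K, (σ = 1 ∨ σ = -1) ∧ IsEigen ρ (kerGen c) (-I) σ p) →
      (P.length + 3 * N.length) % 4 = 0 → P.prod * N.prod ∈ agree v w
  | [], [], _, _, _ => by simp [one_mem]
  | p :: P, q :: N, hP, hN, hl => by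
    simp only [List.forall_mem_cons, List.length_cons, List.prod_cons] at *
    obtain ⟨⟨σ, hσ, hp⟩, hP⟩ := hP
    obtain ⟨⟨σ', hσ', hq⟩, hN⟩ := hN
    convert mul_mem (h.pair_mem hI h2 hI hσ hσ' hp hq)
      (list_prod_mem h hI h2 P N hP hN (by omega)) using 1
    ring
  | p₁ :: p₂ :: p₃ :: p₄ :: P, [], hP, hN, hl => by
    simp only [List.forall_mem_cons, List.length_cons, List.prod_cons] at *
    obtain ⟨⟨σ₁, hσ₁, h₁⟩, ⟨σ₂, hσ₂, h₂⟩, ⟨σ₃, hσ₃, h₃⟩, ⟨σ₄, hσ₄, h₄⟩, hP⟩ := hP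
    convert mul_mem (h.quad_mem hI h2 hI hσ₁ hσ₂ hσ₃ hσ₄ h₁ h₂ h₃ h₄)
      (list_prod_mem h hI h2 P [] hP hN (by simp only [List.length_nil] at *; omega)) using 1
    ring
  | [], p₁ :: p₂ :: p₃ :: p₄ :: N, hP, hN, hl => by
    simp only [List.forall_mem_cons, List.length_cons, List.prod_cons] at *
    obtain ⟨⟨σ₁, hσ₁, h₁⟩, ⟨σ₂, hσ₂, h₂⟩, ⟨σ₃, hσ₃, h₃⟩, ⟨σ₄, hσ₄, h₄⟩, hN⟩ := hN
    convert mul_mem (h.quad_mem hI h2 (by rw [neg_sq, hI]) hσ₁ hσ₂ hσ₃ hσ₄ h₁ h₂ h₃ h₄)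
      (list_prod_mem h hI h2 [] N hP hN (by simp only [List.length_nil] at *; omega)) using 1
    ring
  | [_], [], _, _, hl | [_, _], [], _, _, hl | [_, _, _], [], _, _, hl
  | [], [_], _, _, hl | [], [_, _], _, _, hl | [], [_, _, _], _, _, hl => by simp at hl
  termination_by P N => P.length + N.length

end Anchor

end SeparatingOneCharacter
end NoetherNumber

namespace NoetherNumber

open MvPolynomial C4rtimesC4

section SeparatingUpper

variable {K : Type*} [Field K] {ι : Type*} [Fintype ι] [DecidableEq ι]
variable {ρ : Representation K C4rtimesC4 (ι → K)} {I : K} {v w : ι → K} {c : Ch}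

variable (ρ I c) in
/-- The linear forms which are semi-invariants, or eigenvectors of `kerGen c` for the eigenvalues
`I` and `-I`, and of `b ^ 2`. -/
def eigenForms : Set (MvPolynomial ι K) :=
  {p | (∃ σ : K, (σ = 1 ∨ σ = -1) ∧ IsEigen ρ (kerGen c) I σ p) ∨
    (∃ σ : K, (σ = 1 ∨ σ = -1) ∧ IsEigen ρ (kerGen c) (-I) σ p) ∨ ∃ c', IsSemi ρ I 1 c' p}

theorem IsOdd.mem_adjoin_eigenForms (hI : I ^ 2 = -1) (h2 : (2 : K) ≠ 0) {σ : K}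
    (hσ : σ = 1 ∨ σ = -1) {p : MvPolynomial ι K} (hp : IsOdd ρ σ p) :
    p ∈ Algebra.adjoin K (eigenForms ρ I c) := by
  have hg : act ρ (kerGen c) (act ρ (kerGen c) p) = -p := by
    rw [act_act, ← sq, kerGen_sq, hp.act_aa]
  have hb : act ρ (b ^ 2) (act ρ (kerGen c) p) = σ • act ρ (kerGen c) p := by
    rw [act_act, bb_mul_kerGen, ← act_act, hp.act_bb, map_smul]
  have key : ∀ l : K, l * l = -1 → IsEigen ρ (kerGen c) (-l) σ (p + l • act ρ (kerGen c) p) := by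
    intro l hl
    refine ⟨hp.homog.add ((homogeneousSubmodule ι K 1).smul_mem _ (isHomogeneous_act hp.homog _)),
      ?_, ?_⟩
    · rw [map_add, map_smul, hg, smul_add, smul_smul, neg_mul, hl]
      module
    · rw [map_add, map_smul, hb, hp.act_bb]
      module
  have hI' : I * I = -1 := by rw [← sq, hI]
  have k₁ : p + I • act ρ (kerGen c) p ∈ Algebra.adjoin K (eigenForms ρ I c) :=
    Algebra.subset_adjoin (.inr (.inl ⟨σ, hσ, key I hI'⟩))
  have k₂ : p + (-I) • act ρ (kerGen c) p ∈ Algebra.adjoin K (eigenForms ρ I c) :=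
    Algebra.subset_adjoin (.inl ⟨σ, hσ, by simpa using key (-I) (by rw [neg_mul_neg, hI'])⟩)
  convert Subalgebra.smul_mem _ (add_mem k₁ k₂) ((2 : K)⁻¹) using 1
  match_scalars <;> field_simp <;> ring

theorem adjoin_eigenForms (hI : I ^ 2 = -1) (h2 : (2 : K) ≠ 0) :
    Algebra.adjoin K (eigenForms ρ I c) = ⊤ := by
  rw [eq_top_iff, ← adjoin_centralForms (ρ := ρ) h2, Algebra.adjoin_le_iff]
  have semi : ∀ c' q, IsSemi ρ I 1 c' q →
      q * 1 ∈ (Algebra.adjoin K (eigenForms ρ I c)).toSubmodule := fun c' q hq => by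
    rw [mul_one]
    exact Algebra.subset_adjoin (.inr (.inr ⟨c', hq⟩))
  rintro p (hp | hp | hp | hp)
  · exact hp.mem_adjoin_eigenForms hI h2 (.inl rfl)
  · exact hp.mem_adjoin_eigenForms hI h2 (.inr rfl)
  · rw [← mul_one p]
    exact hp.mul_mem_of_one hI h2 1 _ fun c' _ q hq => semi c' q hq
  · rw [← mul_one p]
    exact hp.mul_mem_of_neg_one hI h2 1 _ fun c' _ q hq => semi c' q hq

theorem exists_act_kerGen_eq_smul (hI : I ^ 2 = -1) {m : MvPolynomial ι K}
    (hm : m ∈ Submonoid.closure (eigenForms ρ I c)) : ∃ μ : K, act ρ (kerGen c) m = μ • m := by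
  induction hm using Submonoid.closure_induction with
  | mem x hx =>
    rcases hx with ⟨σ, -, hx⟩ | ⟨σ, -, hx⟩ | ⟨c', hx⟩
    exacts [⟨_, hx.act_g⟩, ⟨_, hx.act_g⟩, ⟨_, hx.act_kerGen hI c⟩]
  | one => exact ⟨1, by rw [map_one, one_smul]⟩
  | mul x y _ _ hx hy =>
    obtain ⟨μ, hμ⟩ := hx
    obtain ⟨ν, hν⟩ := hy
    exact ⟨μ * ν, by rw [map_mul, hμ, hν, smul_mul_smul_comm]⟩

namespace Anchor

variable {t : MvPolynomial ι K}

/-- A product of linear eigenvectors of `kerGen c` takes the same value at `v` and `w` unless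
`kerGen c` acts on it nontrivially. -/
theorem mem_agree_or_act_eq_smul (h : Anchor ρ I v w c t) (hI : I ^ 2 = -1) (h2 : (2 : K) ≠ 0)
    (hvan : ∀ c', kerSign c c' % 2 = 1 → ∀ t', IsSemi ρ I 1 c' t' →
      eval v t' = 0 ∧ eval w t' = 0)
    {m : MvPolynomial ι K} (hm : m ∈ Submonoid.closure (eigenForms ρ I c)) :
    m ∈ agree v w ∨ ∃ k : ℕ, k % 4 ≠ 0 ∧ act ρ (kerGen c) m = I ^ k • m := by
  have key : (eval v m = 0 ∧ eval w m = 0) ∨ ∃ (P N : List (MvPolynomial ι K))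
      (u : MvPolynomial ι K),
      (∀ p ∈ P, ∃ σ : K, (σ = 1 ∨ σ = -1) ∧ IsEigen ρ (kerGen c) I σ p) ∧
      (∀ p ∈ N, ∃ σ : K, (σ = 1 ∨ σ = -1) ∧ IsEigen ρ (kerGen c) (-I) σ p) ∧
      u ∈ agree v w ∧ act ρ (kerGen c) u = u ∧ m = P.prod * N.prod * u := by
    induction hm using Submonoid.closure_induction_left with
    | one => exact .inr ⟨[], [], 1, by simp, by simp, one_mem _, map_one _, by simp⟩
    | mul_left x hx y _ ih =>
      rcases ih with ⟨hv, hw⟩ | ⟨P, N, u, hP, hN, hu, hgu, rfl⟩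
      · exact .inl ⟨by rw [map_mul, hv, mul_zero], by rw [map_mul, hw, mul_zero]⟩
      · rcases hx with hx | hx | ⟨c', hx⟩
        · exact .inr ⟨x :: P, N, u, List.forall_mem_cons.2 ⟨hx, hP⟩, hN, hu, hgu, by
            rw [List.prod_cons]; ring⟩
        · exact .inr ⟨P, x :: N, u, hP, List.forall_mem_cons.2 ⟨hx, hN⟩, hu, hgu, by
            rw [List.prod_cons]; ring⟩
        · rcases Nat.mod_two_eq_zero_or_one (kerSign c c') with h0 | h1
          · obtain ⟨j, hj⟩ := exists_nsmul_add_eq_zero c c' h.ch h0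
            refine .inr ⟨P, N, x * u, hP, hN, mul_mem (h.semi_mem hI hx hj (by omega)) hu, ?_,
              by ring⟩
            rw [map_mul, hgu, hx.act_kerGen hI, (Nat.even_iff.2 h0).neg_one_pow, one_smul]
          · obtain ⟨hv, hw⟩ := hvan c' h1 x hx
            exact .inl ⟨by rw [map_mul, hv, zero_mul], by rw [map_mul, hw, zero_mul]⟩
  rcases key with ⟨hv, hw⟩ | ⟨P, N, u, hP, hN, hu, hgu, rfl⟩
  · exact .inl (by rw [mem_agree, hv, hw])
  · have act_prod : ∀ (s : K) (L : List (MvPolynomial ι K)),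
        (∀ p ∈ L, ∃ σ : K, (σ = 1 ∨ σ = -1) ∧ IsEigen ρ (kerGen c) s σ p) →
        act ρ (kerGen c) L.prod = s ^ L.length • L.prod := by
      intro s L hL
      induction L with
      | nil => simp
      | cons p L ih =>
        obtain ⟨⟨σ, -, hp⟩, hL⟩ := List.forall_mem_cons.1 hL
        rw [List.prod_cons, map_mul, hp.act_g, ih hL, List.length_cons, pow_succ',
          smul_mul_smul_comm]
    by_cases hk : (P.length + 3 * N.length) % 4 = 0
    · exact .inl (mul_mem (h.list_prod_mem hI h2 P N hP hN hk) hu)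
    · refine .inr ⟨_, hk, ?_⟩
      have hI3 : -I = I ^ 3 := by rw [pow_succ, hI, neg_one_mul]
      rw [map_mul, map_mul, act_prod _ P hP, act_prod _ N hN, hgu, smul_mul_smul_comm,
        smul_mul_assoc, hI3, ← pow_mul, ← pow_add]

theorem invariants_le_agree_of_vanishing (h : Anchor ρ I v w c t) (hI : I ^ 2 = -1)
    (h2 : (2 : K) ≠ 0)
    (hvan : ∀ c', kerSign c c' % 2 = 1 → ∀ t', IsSemi ρ I 1 c' t' →
      eval v t' = 0 ∧ eval w t' = 0) : invariants ρ ≤ agree v w := by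
  set A : MvPolynomial ι K →ₗ[K] MvPolynomial ι K :=
    ∑ i ∈ Finset.range 4, (act ρ (kerGen c ^ i)).toLinearMap with hA
  have hAf : ∀ f, A f = ∑ i ∈ Finset.range 4, act ρ (kerGen c ^ i) f := fun f => by simp [hA]
  have hI4 : I ^ 4 = 1 := by rw [show 4 = 2 * 2 from rfl, pow_mul, hI]; simp
  have key : (⊤ : Submodule K (MvPolynomial ι K)) ≤ (agree v w).toSubmodule.comap A := by
    rw [← Algebra.top_toSubmodule, ← adjoin_eigenForms (ρ := ρ) (c := c) hI h2,
      Algebra.adjoin_eq_span, Submodule.span_le]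
    intro m hm'
    rw [SetLike.mem_coe, Submodule.mem_comap, Subalgebra.mem_toSubmodule, hAf]
    have sum_eq : ∀ {k : ℕ}, act ρ (kerGen c) m = I ^ k • m →
        ∑ i ∈ Finset.range 4, act ρ (kerGen c ^ i) m =
          (1 + I ^ k + (I ^ k) ^ 2 + (I ^ k) ^ 3) • m := by
      intro k hk
      simp only [act_pow_of_act_eq_smul hk, Finset.sum_range_succ, Finset.sum_range_zero]
      module
    rcases h.mem_agree_or_act_eq_smul hI h2 hvan hm' with hm | ⟨k, hk, hkm⟩
    · obtain ⟨μ, hμ⟩ := exists_act_kerGen_eq_smul hI hm'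
      simp only [act_pow_of_act_eq_smul hμ, ← Finset.sum_smul]
      exact Subalgebra.smul_mem _ hm _
    · rw [sum_eq hkm]
      have : 1 + I ^ k + (I ^ k) ^ 2 + (I ^ k) ^ 3 = 0 := by
        have hk4 := pow_eq_pow_mod k hI4
        have : k % 4 = 1 ∨ k % 4 = 2 ∨ k % 4 = 3 := by omega
        rcases this with h | h | h <;> rw [hk4, h]
        · linear_combination (1 + I) * hI
        · rw [hI]; ring
        · linear_combination (1 + I ^ 3) * (1 - I ^ 2 + I ^ 4) * hI
      rw [this, zero_smul]
      exact zero_mem _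
  intro f hf
  have := key (Submodule.mem_top (x := f))
  rw [Submodule.mem_comap, Subalgebra.mem_toSubmodule, hAf,
    Finset.sum_congr rfl fun i _ => hf (kerGen c ^ i), Finset.sum_const, Finset.card_range,
    ← Nat.cast_smul_eq_nsmul K] at this
  have h4 : ((4 : ℕ) : K) ≠ 0 := by
    rw [show ((4 : ℕ) : K) = 2 * 2 by norm_num]; exact mul_ne_zero h2 h2
  have := Subalgebra.smul_mem _ this (((4 : ℕ) : K)⁻¹)
  rwa [smul_smul, inv_mul_cancel₀ h4, one_smul] at this

end Anchor

/-- The invariants of degree at most six separate the orbits. -/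
theorem isSeparating_six (ρ : Representation K C4rtimesC4 (ι → K)) (hI : I ^ 2 = -1)
    (h2 : (2 : K) ≠ 0) : IsSeparating ρ (invariantsLE ρ 6) := by
  intro v w hvw
  have low : ∀ q ∈ invariants ρ, ∀ e ≤ 6, q.IsHomogeneous e → ∀ g, q ∈ agree v (ρ g w) :=
    fun q hq e he hqe g => by
      rw [mem_agree, eval_apply_eq_of_mem_invariants hq]
      exact hvw q ⟨hq, hqe.totalDegree_le.trans he⟩
  suffices ∃ g, invariants ρ ≤ agree v (ρ g w) by
    obtain ⟨g, hg⟩ := this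
    refine isSeparating_invariants ρ v w fun f hf => ?_
    rw [← eval_apply_eq_of_mem_invariants hf g w]
    exact mem_agree.1 (hg hf)
  -- The fourth power of a linear semi-invariant is an invariant.
  have pow_four : ∀ {c t}, IsSemi ρ I 1 c t → eval v t ^ 4 = eval w t ^ 4 := by
    intro c t ht
    have := ht.pow hI 4
    rw [show ∀ c : Ch, 4 • c = 0 by decide] at this
    have := low _ this.mem_invariants 4 (by norm_num) this.homog 1
    simpa [mem_agree] using this
  by_cases h0 : ∀ c : Ch, (c.2 = 1 ∨ c.2 = 3) → ∀ t, IsSemi ρ I 1 c t → eval v t = 0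
  · refine ⟨1, invariants_le_agree_of_vanishing hI h2 (fun q hq e he hqe => low q hq e he hqe 1)
      fun c hc t ht => ⟨h0 c hc t ht, ?_⟩⟩
    have := pow_four ht
    rw [h0 c hc t ht] at this
    simpa using this.symm
  push Not at h0
  obtain ⟨c, hc, t, ht, ht0⟩ := h0
  -- A power of `b` moves `w` to a point at which `t` has the same value as at `v`.
  obtain ⟨g, hg⟩ : ∃ g, eval v t = eval (ρ g w) t := by
    obtain ⟨i, hi⟩ : ∃ i : ℕ, eval v t = I ^ i * eval w t := by
      have h4 := pow_four ht
      have : (eval v t - eval w t) * (eval v t + eval w t) * (eval v t - I * eval w t) *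
          (eval v t - I ^ 3 * eval w t) = 0 := by
        linear_combination h4 + (eval v t ^ 2 - eval w t ^ 2) *
          (I ^ 2 * eval w t ^ 2 - eval w t ^ 2 - I * eval v t * eval w t) * hI
      rcases mul_eq_zero.1 this with h | h
      · rcases mul_eq_zero.1 h with h | h
        · rcases mul_eq_zero.1 h with h | h
          · exact ⟨0, by linear_combination h⟩
          · exact ⟨2, by rw [hI]; linear_combination h⟩
        · exact ⟨1, by linear_combination h⟩
      · exact ⟨3, by linear_combination h⟩
    refine ⟨(b ^ (c.2.val * i))⁻¹, ?_⟩
    have hb := eval_act ρ (b ^ (c.2.val * i)) t w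
    have hI4 : I ^ 4 = 1 := by rw [show 4 = 2 * 2 from rfl, pow_mul, hI]; simp
    have hkk : I ^ (c.2.val * c.2.val) = I := by
      rw [pow_eq_pow_mod _ hI4, show c.2.val * c.2.val % 4 = 1 by
        rcases hc with hc | hc <;> rw [hc] <;> decide, pow_one]
    rw [← hb, act_pow_of_act_eq_smul ht.act_b, smul_eval, hi, ← pow_mul, ← mul_assoc, pow_mul, hkk]
  set w' := ρ g w with hw'
  have anchor : ∀ g', act ρ g'⁻¹ t = t → Anchor ρ I v (ρ g' w') c t := fun g' hg' => by
    refine ⟨fun q hq e he hqe => ?_, hc, ht, ?_, ht0⟩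
    · have := low q hq e he hqe (g' * g)
      rwa [map_mul, Module.End.mul_apply] at this
    · rw [mem_agree, hg, ← hg', eval_act, hg', inv_inv]
  have anchor_one := anchor 1 (by rw [inv_one, act_one])
  rw [map_one, Module.End.one_apply] at anchor_one
  by_cases hB : ∃ c', kerSign c c' % 2 = 1 ∧ ∃ t', IsSemi ρ I 1 c' t' ∧ eval v t' ≠ 0
  · obtain ⟨c', hcc', t', ht', ht'0⟩ := hB
    -- The squares of the values of `t'` at `v` and `w'` agree; `kerGen c` adjusts the sign.
    have hsq : t' ^ 2 ∈ agree v w' := by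
      obtain ⟨j, hj⟩ := exists_two_nsmul_add_eq_zero c c' hc
      exact anchor_one.semi_mem hI (ht'.pow hI 2) hj (by omega)
    rw [mem_agree, map_pow, map_pow] at hsq
    rcases sq_eq_sq_iff_eq_or_eq_neg.1 hsq with h | h
    · exact ⟨g, anchor_one.invariants_le_agree_of_two hI h2 ht' hcc' (mem_agree.2 h) ht'0⟩
    · have hfix : act ρ (kerGen c) t = t := by
        rw [ht.act_kerGen hI, Even.neg_one_pow, one_smul]
        rw [Nat.even_iff]
        exact (show ∀ c : Ch, (c.2 = 1 ∨ c.2 = 3) → kerSign c c % 2 = 0 by decide) c hc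
      have hA := anchor (kerGen c)⁻¹ (by rwa [inv_inv])
      refine ⟨(kerGen c)⁻¹ * g, ?_⟩
      rw [map_mul, Module.End.mul_apply]
      refine hA.invariants_le_agree_of_two hI h2 ht' hcc' (mem_agree.2 ?_) ht'0
      rw [← eval_act, ht'.act_kerGen hI, (Nat.odd_iff.2 hcc').neg_one_pow, smul_eval, h,
        neg_one_mul]
  · push Not at hB
    refine ⟨g, anchor_one.invariants_le_agree_of_vanishing hI h2 fun c' hcc' t' ht' => ?_⟩
    have hv := hB c' hcc' t' ht'
    refine ⟨hv, ?_⟩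
    obtain ⟨μ, hμ⟩ := ht'.exists_act_eq_smul g⁻¹
    have hw : eval w t' = 0 := by
      have := pow_four ht'
      rw [hv] at this
      simpa using this.symm
    have := eval_act ρ g⁻¹ t' w
    rw [inv_inv, hμ, smul_eval, hw, mul_zero] at this
    exact this.symm

theorem betaSepRep_le_six (ρ : Representation K C4rtimesC4 (ι → K)) (hI : I ^ 2 = -1)
    (h2 : (2 : K) ≠ 0) : betaSepRep ρ ≤ 6 :=
  iInf_le (fun d : {d : ℕ // IsSeparating ρ (invariantsLE ρ d)} => ((d : ℕ) : ℕ∞))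
    ⟨6, isSeparating_six ρ hI h2⟩

end SeparatingUpper
end NoetherNumber

/-! ### Monomial representations of `C₄ ⋊ C₄` -/

namespace C4rtimesC4

/-- The homomorphism from `C₄ ⋊ C₄` to a monoid given by the images of the generators. -/
def lift {M : Type*} [Monoid M] (A B : M) (hA : A ^ 4 = 1) (hB : B ^ 4 = 1)
    (hBA : B * A = A ^ 3 * B) : C4rtimesC4 →* M where
  toFun g := A ^ (Multiplicative.toAdd g.left).val * B ^ (Multiplicative.toAdd g.right).val
  map_one' := by simp
  map_mul' g h := by
    have h₁ : ∀ n : ℕ, B * A ^ n = A ^ (3 * n) * B := by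
      intro n
      rw [pow_mul]
      exact (show SemiconjBy B A (A ^ 3) from hBA).pow_right n
    have h₂ : ∀ k n : ℕ, B ^ k * A ^ n = A ^ (3 ^ k * n) * B ^ k := by
      intro k
      induction k with
      | zero => simp
      | succ k ih =>
        intro n
        rw [pow_succ, mul_assoc, h₁, ← mul_assoc, ih, pow_succ, mul_assoc, mul_assoc]
    obtain ⟨x, k⟩ := g
    obtain ⟨y, l⟩ := h
    have h₃ : ∀ x k y : C4, (Multiplicative.toAdd (x * c4Action k y)).val % 4 =
        ((Multiplicative.toAdd x).val + 3 ^ (Multiplicative.toAdd k).val *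
          (Multiplicative.toAdd y).val) % 4 := by decide
    have h₄ : ∀ k l : C4, (Multiplicative.toAdd (k * l)).val % 4 =
        ((Multiplicative.toAdd k).val + (Multiplicative.toAdd l).val) % 4 := by decide
    rw [SemidirectProduct.mul_left, SemidirectProduct.mul_right]
    dsimp only
    rw [pow_eq_pow_mod _ hA, h₃, ← pow_eq_pow_mod _ hA, pow_eq_pow_mod _ hB, h₄,
      ← pow_eq_pow_mod _ hB, pow_add, pow_add, mul_assoc, ← mul_assoc (A ^ (_ * _)), ← h₂]
    simp only [mul_assoc]

variable {M : Type*} [Monoid M] {A B : M} (hA : A ^ 4 = 1) (hB : B ^ 4 = 1)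
    (hBA : B * A = A ^ 3 * B)

theorem lift_a : lift A B hA hB hBA a = A := by
  simp [lift, a, show ZMod.val (1 : ZMod 4) = 1 from rfl]

theorem lift_b : lift A B hA hB hBA b = B := by
  simp [lift, b, show ZMod.val (1 : ZMod 4) = 1 from rfl]

end C4rtimesC4

namespace NoetherNumber

open MvPolynomial C4rtimesC4

section Monomial

variable {K : Type*} [Field K] {ι : Type*}

/-- The monomial linear map `v ↦ (α i * v (τ i))ᵢ`. -/
def monoMap (α : ι → K) (τ : Equiv.Perm ι) : Module.End K (ι → K) where
  toFun v i := α i * v (τ i)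
  map_add' v w := by ext i; simp [mul_add]
  map_smul' r v := by ext i; simp [mul_left_comm]

variable [Fintype ι]

/-- The substitution `X i ↦ α i * X (τ i)`, by which a monomial map acts on polynomials. -/
noncomputable def monoSubst (α : ι → K) (τ : Equiv.Perm ι) :
    MvPolynomial ι K →ₐ[K] MvPolynomial ι K :=
  aeval fun i => C (α i) * X (τ i)

theorem monoSubst_monomial (α : ι → K) (τ : Equiv.Perm ι) (m : ι →₀ ℕ) (r : K) :
    monoSubst α τ (monomial m r) = monomial (m.mapDomain τ) ((∏ i, α i ^ m i) * r) := by
  rw [monoSubst, aeval_monomial, Finsupp.prod_fintype _ _ (by simp)]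
  simp only [mul_pow, Finset.prod_mul_distrib, ← C_pow]
  rw [← map_prod C, algebraMap_eq, ← mul_assoc, ← C_mul, mul_comm r, monomial_eq,
    Finsupp.prod_mapDomain_index (by simp) (by simp [pow_add]),
    Finsupp.prod_fintype _ _ (by simp)]

theorem coeff_monoSubst (α : ι → K) (τ : Equiv.Perm ι) (m : ι →₀ ℕ) (f : MvPolynomial ι K) :
    coeff (m.mapDomain τ) (monoSubst α τ f) = (∏ i, α i ^ m i) * coeff m f := by
  classical
  induction f using MvPolynomial.induction_on' with
  | monomial n r =>
    rw [monoSubst_monomial, coeff_monomial, coeff_monomial]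
    by_cases h : n = m
    · subst h; simp
    · rw [if_neg h, if_neg fun h' => h (Finsupp.mapDomain_injective τ.injective h'), mul_zero]
  | add p q hp hq => rw [map_add, coeff_add, hp, hq, coeff_add, mul_add]

variable [DecidableEq ι]

theorem act_inv_eq_monoSubst {G : Type*} [Group G] {ρ : Representation K G (ι → K)} {g : G}
    {α : ι → K} {τ : Equiv.Perm ι} (h : ρ g = monoMap α τ) : act ρ g⁻¹ = monoSubst α τ := by
  apply MvPolynomial.algHom_ext
  intro i
  rw [act, monoSubst, aeval_X, aeval_X, inv_inv, h, Matrix.toMvPolynomial,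
    Finset.sum_eq_single (τ i)]
  · simp [LinearMap.toMatrix'_apply, monoMap, C_mul_X_eq_monomial]
  · intro j _ hj
    simp [LinearMap.toMatrix'_apply, monoMap, hj.symm]
  · simp

theorem mem_invariants_of_monoSubst {ρ : Representation K C4rtimesC4 (ι → K)} {α β : ι → K}
    {τ υ : Equiv.Perm ι} (ha : ρ a = monoMap α τ) (hb : ρ b = monoMap β υ)
    {f : MvPolynomial ι K} (hfa : monoSubst α τ f = f) (hfb : monoSubst β υ f = f) :
    f ∈ invariants ρ := by
  apply mem_invariants_of_generators
  · nth_rewrite 1 [← hfa]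
    rw [← act_inv_eq_monoSubst ha, act_act, mul_inv_cancel, act_one]
  · nth_rewrite 1 [← hfb]
    rw [← act_inv_eq_monoSubst hb, act_act, mul_inv_cancel, act_one]

theorem coeff_mapDomain_of_mem_invariants {G : Type*} [Group G] {ρ : Representation K G (ι → K)}
    {g : G} {α : ι → K} {τ : Equiv.Perm ι} (h : ρ g = monoMap α τ) {f : MvPolynomial ι K}
    (hf : f ∈ invariants ρ) (m : ι →₀ ℕ) :
    coeff (m.mapDomain τ) f = (∏ i, α i ^ m i) * coeff m f := by
  have := coeff_monoSubst α τ m f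
  rwa [← act_inv_eq_monoSubst h, hf g⁻¹] at this

omit [DecidableEq ι] in
theorem sum_le_of_coeff_ne_zero {f : MvPolynomial ι K} {m : ι →₀ ℕ} (h : coeff m f ≠ 0) :
    ∑ i, m i ≤ f.totalDegree := by
  have := le_totalDegree (mem_support_iff.2 h)
  rwa [Finsupp.sum_fintype _ _ (by simp)] at this

end Monomial

theorem mod_four_eq_zero_of_pow_eq_one {K : Type*} [Field K] {I : K} (hI : I ^ 2 = -1)
    (h2 : (2 : K) ≠ 0) {k : ℕ} (h : I ^ k = 1) : k % 4 = 0 := by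
  have hI4 : I ^ 4 = 1 := by rw [show 4 = 2 * 2 from rfl, pow_mul, hI]; simp
  rw [pow_eq_pow_mod _ hI4] at h
  have : k % 4 = 0 ∨ k % 4 = 1 ∨ k % 4 = 2 ∨ k % 4 = 3 := by omega
  rcases this with e | e | e | e
  · exact e
  · rw [e] at h
    exact absurd (show (2 : K) = 0 by linear_combination hI - (I + 1) * h) h2
  · rw [e] at h
    exact absurd (show (2 : K) = 0 by linear_combination hI - h) h2
  · rw [e] at h
    exact absurd
      (show (2 : K) = 0 by linear_combination (I ^ 4 - I ^ 2 + 1) * hI - (I ^ 3 + 1) * h) h2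

end NoetherNumber

namespace NoetherNumber

open MvPolynomial C4rtimesC4

/-! ### The lower bound for the separating Noether number -/

section LowerSep

variable {K : Type*} [Field K] {I : K}

/-- The two-dimensional irreducible representation with kernel generated by `a ^ 2 * b ^ 2`,
factoring through the quaternion group. -/
def quatRep (hI : I ^ 2 = -1) : Representation K C4rtimesC4 (Fin 2 → K) :=
  lift (monoMap ![I, -I] 1) (monoMap ![1, -1] (Equiv.swap 0 1))
    (by
      have h4 : I ^ 4 = 1 := by rw [show 4 = 2 * 2 from rfl, pow_mul, hI]; simp
      refine LinearMap.ext fun v => funext fun i => ?_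
      fin_cases i <;> simp [pow_succ, monoMap] <;> linear_combination v _ * h4)
    (by
      refine LinearMap.ext fun v => funext fun i => ?_
      fin_cases i <;> simp [pow_succ, monoMap])
    (by
      refine LinearMap.ext fun v => funext fun i => ?_
      fin_cases i <;> simp [pow_succ, monoMap]
      · linear_combination -I * v 1 * hI
      · linear_combination -I * v 0 * hI)

theorem quatRep_a (hI : I ^ 2 = -1) : quatRep hI a = monoMap ![I, -I] 1 := lift_a _ _ _

theorem quatRep_b (hI : I ^ 2 = -1) : quatRep hI b = monoMap ![1, -1] (Equiv.swap 0 1) :=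
  lift_b _ _ _

/-- The invariant of degree six of the quaternion group, which changes its sign under the
exchange of the coordinates. -/
theorem quatRep_sextic (hI : I ^ 2 = -1) (g : C4rtimesC4) (v : Fin 2 → K) :
    (quatRep hI g v) 0 * (quatRep hI g v) 1 * ((quatRep hI g v) 0 ^ 4 - (quatRep hI g v) 1 ^ 4) =
      v 0 * v 1 * (v 0 ^ 4 - v 1 ^ 4) := by
  have h4 : I ^ 4 = 1 := by rw [show 4 = 2 * 2 from rfl, pow_mul, hI]; simp
  have ha : ∀ (n : ℕ) (v : Fin 2 → K), (quatRep hI (a ^ n) v) 0 * (quatRep hI (a ^ n) v) 1 *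
      ((quatRep hI (a ^ n) v) 0 ^ 4 - (quatRep hI (a ^ n) v) 1 ^ 4) =
      v 0 * v 1 * (v 0 ^ 4 - v 1 ^ 4) := by
    intro n
    induction n with
    | zero => simp
    | succ n ih =>
      intro v
      rw [pow_succ, map_mul, Module.End.mul_apply, ih, quatRep_a]
      simp only [monoMap, LinearMap.coe_mk, AddHom.coe_mk, Equiv.Perm.one_apply,
        Matrix.cons_val_zero, Matrix.cons_val_one]
      linear_combination (-I ^ 4 * v 0 * v 1 * (v 0 ^ 4 - v 1 ^ 4)) * hI +
        v 0 * v 1 * (v 0 ^ 4 - v 1 ^ 4) * h4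
  have hb : ∀ (n : ℕ) (v : Fin 2 → K), (quatRep hI (b ^ n) v) 0 * (quatRep hI (b ^ n) v) 1 *
      ((quatRep hI (b ^ n) v) 0 ^ 4 - (quatRep hI (b ^ n) v) 1 ^ 4) =
      v 0 * v 1 * (v 0 ^ 4 - v 1 ^ 4) := by
    intro n
    induction n with
    | zero => simp
    | succ n ih =>
      intro v
      rw [pow_succ, map_mul, Module.End.mul_apply, ih, quatRep_b]
      simp only [monoMap, LinearMap.coe_mk, AddHom.coe_mk, Equiv.swap_apply_left,
        Equiv.swap_apply_right, Matrix.cons_val_zero, Matrix.cons_val_one]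
      ring
  obtain ⟨i, j, rfl⟩ := eq_pow_mul_pow g
  rw [map_mul, Module.End.mul_apply, ha, hb]

/-- The invariants of degree at most five are symmetric in the two coordinates. -/
theorem rename_swap_eq_of_mem_invariants_quatRep (hI : I ^ 2 = -1) (h2 : (2 : K) ≠ 0)
    {f : MvPolynomial (Fin 2) K} (hf : f ∈ invariants (quatRep hI)) (hd : f.totalDegree ≤ 5) :
    rename (Equiv.swap 0 1) f = f := by
  ext m
  obtain ⟨n, rfl⟩ : ∃ n : Fin 2 →₀ ℕ, n.mapDomain (Equiv.swap 0 1) = m :=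
    ⟨m.mapDomain (Equiv.swap 0 1), by ext i; fin_cases i <;> simp [Finsupp.mapDomain_equiv_apply]⟩
  rw [coeff_rename_mapDomain _ (Equiv.injective _)]
  have hb := coeff_mapDomain_of_mem_invariants (quatRep_b hI) hf n
  simp only [Fin.prod_univ_two, Matrix.cons_val_zero, Matrix.cons_val_one, one_pow, one_mul] at hb
  by_cases h0 : coeff n f = 0
  · rw [hb, h0, mul_zero]
  have ha := coeff_mapDomain_of_mem_invariants (quatRep_a hI) hf n
  simp only [Fin.prod_univ_two, Matrix.cons_val_zero, Matrix.cons_val_one, Equiv.Perm.coe_one,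
    Finsupp.mapDomain_id] at ha
  have hw : I ^ (n 0 + 3 * n 1) = 1 := by
    have hI3 : -I = I ^ 3 := by rw [pow_succ, hI, neg_one_mul]
    rw [pow_add, pow_mul, ← hI3]
    exact mul_right_cancel₀ h0 (by rw [← ha, one_mul])
  have hw4 := mod_four_eq_zero_of_pow_eq_one hI h2 hw
  have hsum := sum_le_of_coeff_ne_zero h0
  rw [Fin.sum_univ_two] at hsum
  rcases Nat.even_or_odd (n 1) with he | ho
  · rw [hb, he.neg_one_pow, one_mul]
  · -- The only exponents left are those of the product of the two variables.
    obtain ⟨k, hk⟩ := ho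
    have h1 : n 1 = 1 ∧ n 0 = 1 := by omega
    congr 1
    ext i
    fin_cases i <;> simp [Finsupp.mapDomain_equiv_apply, h1.1, h1.2]

theorem six_le_betaSepRep_quatRep {ζ : K} (hI : (ζ ^ 2) ^ 2 = -1) (h2 : (2 : K) ≠ 0) :
    6 ≤ betaSepRep (quatRep hI) := by
  have hζ : ζ ^ 4 = -1 := by rw [← hI]; ring
  have hζ0 : ζ ≠ 0 := by
    rintro rfl
    apply h2
    linear_combination 2 * hζ
  refine le_betaSepRep (m := 6) (v := ![1, ζ]) (w := ![ζ, 1]) (fun d hd f hf => ?_) fun g hg => ?_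
  · have h := rename_swap_eq_of_mem_invariants_quatRep hI h2 hf.1 (hf.2.trans (by omega))
    nth_rewrite 2 [← h]
    rw [eval_rename]
    congr 2
    ext i
    fin_cases i <;> simp
  · have h := quatRep_sextic hI g ![1, ζ]
    rw [hg] at h
    simp only [Matrix.cons_val_zero, Matrix.cons_val_one, one_pow, hζ] at h
    have : (2 : K) * 2 * ζ = 0 := by linear_combination -h
    exact mul_ne_zero (mul_ne_zero h2 h2) hζ0 this

end LowerSep

/-! ### The lower bound for the Noether number -/

section Lower

variable {K : Type*} [Field K] {I : K}

/-- The exchange of the two basis vectors in both irreducible modules of dimension two. -/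
def swapPairs : Equiv.Perm (Fin 5) := Equiv.swap 0 1 * Equiv.swap 2 3

theorem swapPairs_symm : swapPairs.symm = swapPairs := by decide

theorem swapPairs_apply : swapPairs 0 = 1 ∧ swapPairs 1 = 0 ∧ swapPairs 2 = 3 ∧ swapPairs 3 = 2 ∧
    swapPairs 4 = 4 := by decide

/-- The sum of the two irreducible representations of dimension two (on the coordinates `0, 1`
and `2, 3`) and of a linear character of order four. -/
def sumRep (hI : I ^ 2 = -1) : Representation K C4rtimesC4 (Fin 5 → K) :=
  lift (monoMap ![I, -I, I, -I, 1] 1) (monoMap ![1, 1, 1, -1, I] swapPairs)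
    (by
      have h4 : I ^ 4 = 1 := by rw [show 4 = 2 * 2 from rfl, pow_mul, hI]; simp
      refine LinearMap.ext fun v => funext fun i => ?_
      fin_cases i <;> simp [pow_succ, monoMap] <;> linear_combination v _ * h4)
    (by
      have h4 : I ^ 4 = 1 := by rw [show 4 = 2 * 2 from rfl, pow_mul, hI]; simp
      refine LinearMap.ext fun v => funext fun i => ?_
      fin_cases i <;> simp [pow_succ, monoMap, swapPairs_apply]
      linear_combination v _ * h4)
    (by
      refine LinearMap.ext fun v => funext fun i => ?_
      fin_cases i <;> simp [pow_succ, monoMap, swapPairs_apply]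
      · linear_combination -I * v 1 * hI
      · linear_combination I * v 0 * hI
      · linear_combination -I * v 3 * hI
      · linear_combination -I * v 2 * hI)

theorem sumRep_a (hI : I ^ 2 = -1) : sumRep hI a = monoMap ![I, -I, I, -I, 1] 1 := lift_a _ _ _

theorem sumRep_b (hI : I ^ 2 = -1) : sumRep hI b = monoMap ![1, 1, 1, -1, I] swapPairs :=
  lift_b _ _ _

theorem mapDomain_swapPairs (m : Fin 5 →₀ ℕ) (i : Fin 5) :
    m.mapDomain swapPairs i = m (swapPairs i) := by
  rw [Finsupp.mapDomain_equiv_apply, swapPairs_symm]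

theorem mapDomain_swapPairs_mapDomain (m : Fin 5 →₀ ℕ) :
    (m.mapDomain swapPairs).mapDomain swapPairs = m := by
  ext i
  rw [mapDomain_swapPairs, mapDomain_swapPairs]
  congr 1
  revert i; decide

theorem coeff_rename_swapPairs (p : MvPolynomial (Fin 5) K) (m : Fin 5 →₀ ℕ) :
    coeff m (rename swapPairs p) = coeff (m.mapDomain swapPairs) p := by
  conv_lhs => rw [← mapDomain_swapPairs_mapDomain m]
  rw [coeff_rename_mapDomain _ (Equiv.injective _)]

/-- A subalgebra containing the invariants of degree at most six. With coordinates `x, y, u, v, t`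
its elements are the `a`-invariant polynomials such that the coefficient of `y ^ 3 v t ^ k` is
`I` times the coefficient of `x ^ 3 u t ^ k` for all `k`. It is closed under products since an
`a`-invariant monomial properly dividing `x ^ 3 u t ^ k` is a power of `t`, or has a power of `t`
as cofactor. -/
noncomputable def twistedSubalgebra (I : K) : Subalgebra K (MvPolynomial (Fin 5) K) where
  carrier := {p | (∀ m, coeff m p ≠ 0 → (m 0 + 3 * m 1 + m 2 + 3 * m 3) % 4 = 0) ∧
    ∀ m, m 0 = 3 → m 1 = 0 → m 2 = 1 → m 3 = 0 →
      coeff (m.mapDomain swapPairs) p = I * coeff m p}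
  algebraMap_mem' r := by
    simp only [algebraMap_eq, Set.mem_ofPred_eq, coeff_C]
    refine ⟨fun m hm => ?_, fun m h0 h1 h2 h3 => ?_⟩
    · have : 0 = m := by by_contra h; simp [h] at hm
      subst this; simp
    · rw [if_neg, if_neg, mul_zero]
      · rintro rfl; simp at h0
      · intro h
        have := DFunLike.congr_fun h 1
        rw [mapDomain_swapPairs, swapPairs_apply.2.1, h0] at this
        simp at this
  add_mem' {p q} hp hq := by
    refine ⟨fun m hm => ?_, fun m h0 h1 h2 h3 => ?_⟩
    · rw [coeff_add] at hm
      by_cases h : coeff m p = 0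
      · exact hq.1 m fun h' => hm (by rw [h, h', add_zero])
      · exact hp.1 m h
    · rw [coeff_add, coeff_add, hp.2 m h0 h1 h2 h3, hq.2 m h0 h1 h2 h3, mul_add]
  mul_mem' {p q} hp hq := by
    refine ⟨fun m hm => ?_, fun m h0 h1 h2 h3 => ?_⟩
    · rw [coeff_mul] at hm
      obtain ⟨⟨m₁, m₂⟩, hmem, hne⟩ := Finset.exists_ne_zero_of_sum_ne_zero hm
      rw [Finset.HasAntidiagonal.mem_antidiagonal] at hmem
      have e₁ := hp.1 m₁ (left_ne_zero_of_mul hne)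
      have e₂ := hq.1 m₂ (right_ne_zero_of_mul hne)
      simp only [← hmem, Finsupp.add_apply]
      omega
    · rw [← coeff_rename_swapPairs, map_mul, coeff_mul, coeff_mul, Finset.mul_sum]
      refine Finset.sum_congr rfl fun x hx => ?_
      obtain ⟨m₁, m₂⟩ := x
      rw [Finset.HasAntidiagonal.mem_antidiagonal] at hx
      dsimp only at hx ⊢
      rw [coeff_rename_swapPairs, coeff_rename_swapPairs]
      have e : ∀ i, m₁ i + m₂ i = m i := fun i => by rw [← hx, Finsupp.add_apply]
      have e0 := e 0
      have e1 := e 1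
      have e2 := e 2
      have e3 := e 3
      have fix : ∀ n : Fin 5 →₀ ℕ, n 0 = 0 → n 1 = 0 → n 2 = 0 → n 3 = 0 →
          n.mapDomain swapPairs = n := by
        intro n g0 g1 g2 g3
        ext i
        rw [mapDomain_swapPairs]
        fin_cases i <;> simp [swapPairs_apply, g0, g1, g2, g3]
      rcases Nat.eq_zero_or_pos ((m₁ 0 + m₁ 2) % 4) with hz | hz
      · rcases Nat.eq_zero_or_pos (m₁ 0) with hm0 | hm0
        · rw [fix m₁ hm0 (by omega) (by omega) (by omega),
            hq.2 m₂ (by omega) (by omega) (by omega) (by omega)]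
          ring
        · rw [fix m₂ (by omega) (by omega) (by omega) (by omega),
            hp.2 m₁ (by omega) (by omega) (by omega) (by omega)]
          ring
      · have c1 : coeff m₁ p = 0 := by
          by_contra h
          have := hp.1 m₁ h
          omega
        have c2 : coeff (m₁.mapDomain swapPairs) p = 0 := by
          by_contra h
          have := hp.1 _ h
          simp only [mapDomain_swapPairs, swapPairs_apply] at this
          omega
        rw [c1, c2]
        ring

theorem invariantsLE_six_subset (hI : I ^ 2 = -1) (h2 : (2 : K) ≠ 0) :
    invariantsLE (sumRep hI) 6 ⊆ (twistedSubalgebra I : Set (MvPolynomial (Fin 5) K)) := by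
  rintro f ⟨hf, hd⟩
  refine ⟨fun m hm => ?_, fun m h0 h1 h2' h3 => ?_⟩
  · have ha := coeff_mapDomain_of_mem_invariants (sumRep_a hI) hf m
    simp only [Fin.prod_univ_five, Equiv.Perm.coe_one, Finsupp.mapDomain_id] at ha
    apply mod_four_eq_zero_of_pow_eq_one hI h2
    have hI3 : I ^ 3 = -I := by rw [pow_succ, hI, neg_one_mul]
    rw [pow_add, pow_add, pow_add, pow_mul, pow_mul, hI3]
    refine mul_right_cancel₀ hm ?_
    rw [one_mul]
    conv_rhs => rw [ha]
    simp
  · have hb₁ := coeff_mapDomain_of_mem_invariants (sumRep_b hI) hf m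
    have hb₂ := coeff_mapDomain_of_mem_invariants (sumRep_b hI) hf (m.mapDomain swapPairs)
    rw [mapDomain_swapPairs_mapDomain] at hb₂
    simp [Fin.prod_univ_five, swapPairs_symm, swapPairs_apply, h0, h1, h2', h3] at hb₁ hb₂
    set c := coeff m f with hc
    set c' := coeff (m.mapDomain swapPairs) f with hc'
    have zero : (2 : K) * c = 0 → c' = I * c := by
      intro h
      have h' : c = 0 := (mul_eq_zero.1 h).resolve_left h2
      rw [hb₁, h', mul_zero, mul_zero]
    by_cases hc0 : c = 0
    · exact zero (by rw [hc0, mul_zero])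
    have hsum := (sum_le_of_coeff_ne_zero hc0).trans hd
    rw [Fin.sum_univ_five, h0, h1, h2', h3] at hsum
    have : m 4 = 0 ∨ m 4 = 1 ∨ m 4 = 2 := by omega
    rcases this with h | h | h <;> rw [h] at hb₁ hb₂
    · apply zero
      linear_combination hb₂ - hb₁
    · rw [hb₁, pow_one]
    · apply zero
      rw [hI] at hb₁ hb₂
      linear_combination hb₂ + hb₁

/-- The exponents of `x ^ 3 u t ^ 3`. -/
noncomputable def topExponent : Fin 5 →₀ ℕ := Finsupp.equivFunOnFinite.symm ![3, 0, 1, 0, 3]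

theorem seven_le_betaRep_sumRep (hI : I ^ 2 = -1) (h2 : (2 : K) ≠ 0) :
    7 ≤ betaRep (sumRep hI) := by
  have hne : topExponent ≠ topExponent.mapDomain swapPairs := by
    intro h
    have := DFunLike.congr_fun h 0
    rw [mapDomain_swapPairs, swapPairs_apply.1] at this
    simp [topExponent] at this
  set f : MvPolynomial (Fin 5) K :=
    monomial topExponent 1 + monomial (topExponent.mapDomain swapPairs) (-I) with hf
  have hI3 : I ^ 3 = -I := by rw [pow_succ, hI, neg_one_mul]
  have hinv : f ∈ invariants (sumRep hI) := by
    refine mem_invariants_of_monoSubst (sumRep_a hI) (sumRep_b hI) ?_ ?_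
    · have h4 : I ^ 4 = 1 := by rw [show 4 = 2 * 2 from rfl, pow_mul, hI]; simp
      rw [hf, map_add, monoSubst_monomial, monoSubst_monomial]
      simp only [Equiv.Perm.coe_one, Finsupp.mapDomain_id]
      congr 2
      · simp [Fin.prod_univ_five, topExponent]
        linear_combination h4
      · simp [Fin.prod_univ_five, swapPairs_symm, swapPairs_apply, topExponent]
        linear_combination -I * h4
    · rw [hf, map_add, monoSubst_monomial, monoSubst_monomial, mapDomain_swapPairs_mapDomain,
        add_comm]
      congr 2
      · simp [Fin.prod_univ_five, swapPairs_symm, swapPairs_apply, topExponent]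
        linear_combination (I ^ 2 - 1) * hI
      · simp [Fin.prod_univ_five, topExponent, hI3]
  refine le_betaRep (m := 7) hinv fun d hd hmem => ?_
  have hsub : Algebra.adjoin K (invariantsLE (sumRep hI) d) ≤ twistedSubalgebra I :=
    Algebra.adjoin_le fun p hp =>
      invariantsLE_six_subset hI h2 ⟨hp.1, hp.2.trans (by omega)⟩
  have h := (hsub hmem).2 topExponent (by simp [topExponent]) (by simp [topExponent])
    (by simp [topExponent]) (by simp [topExponent])
  rw [hf, coeff_add, coeff_add, coeff_monomial, coeff_monomial, coeff_monomial, coeff_monomial,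
    if_neg hne, if_pos rfl, if_pos rfl, if_neg hne.symm, zero_add, add_zero, mul_one] at h
  have hI0 : I ≠ 0 := by
    rintro rfl
    apply h2
    linear_combination 2 * hI
  have : (2 : K) * I = 0 := by linear_combination -h
  exact mul_ne_zero h2 hI0 this

end Lower
end NoetherNumber

theorem theorem5p11 {K : Type*} [Field K] (hK : ∃ ζ : K, orderOf ζ = 8) :
    NoetherNumber.betaSep K C4rtimesC4 = 6 ∧ NoetherNumber.beta K C4rtimesC4 = 7 := by
  obtain ⟨ζ, hζ⟩ := hK
  have h8 : ζ ^ 8 = 1 := hζ ▸ pow_orderOf_eq_one ζ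
  have h4 : ζ ^ 4 ≠ 1 := pow_ne_one_of_lt_orderOf (by norm_num) (by rw [hζ]; norm_num)
  have hI : (ζ ^ 2) ^ 2 = -1 := by
    have h : (ζ ^ 4 - 1) * (ζ ^ 4 + 1) = 0 := by linear_combination h8
    have := (mul_eq_zero.1 h).resolve_left (sub_ne_zero.2 h4)
    linear_combination this
  have h2 : (2 : K) ≠ 0 := fun h => h4 (by linear_combination hI - h)
  constructor
  · exact le_antisymm (iSup₂_le fun n ρ => NoetherNumber.betaSepRep_le_six ρ hI h2)
      ((NoetherNumber.six_le_betaSepRep_quatRep hI h2).trans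
        (le_iSup₂ (f := fun (n : ℕ) (ρ : Representation K C4rtimesC4 (Fin n → K)) =>
          NoetherNumber.betaSepRep ρ) 2 (NoetherNumber.quatRep hI)))
  · exact le_antisymm (iSup₂_le fun n ρ => NoetherNumber.betaRep_le_seven ρ hI h2)
      ((NoetherNumber.seven_le_betaRep_sumRep hI h2).trans
        (le_iSup₂ (f := fun (n : ℕ) (ρ : Representation K C4rtimesC4 (Fin n → K)) =>
          NoetherNumber.betaRep ρ) 5 (NoetherNumber.sumRep hI)))
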